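/- Let $l_1,l_2,l_3,l_4$ be the eigenlines in $\mathbb{R}^4$ of a hyperbolic operator, i.e. of some $A\in\mathrm{GL}_4(\mathbb{Z})$ all of whose eigenvalues are real and whose characteristic polynomial is irreducible over $\mathbb{Q}$. The hyperplanes spanned by triples of these lines divide $\mathbb{R}^4$ into $16$ simplicial cones; the sail of such a cone $C$ is the boundary of the convex hull of $C\cap\mathbb{Z}^4\setminus\{0\}$, and the algebraic continued fraction $\mathrm{CF}(l_1,l_2,l_3,l_4)$ is the union of the $16$ sails. A proper palindromic symmetry of it is an operator $G\in\mathrm{GL}_4(\mathbb{Z})$ such that $G(\mathrm{CF}(l_1,l_2,l_3,l_4))=\mathrm{CF}(l_1,l_2,l_3,l_4)$, $G(l_i)\neq l_i$ for at least one $i$, and $G$ has a fixed point on one of the sails. For $v,w\in\mathbb{R}^4$ write $v\sim w$ if $Xv=\mu w$ for some $X\in\mathrm{GL}_4(\mathbb{Z})$ and some nonzero $\mu\in\mathbb{R}$. Suppose that $l_1$ is spanned by $(1,\alpha,\beta,\gamma)$ and let $K=\mathbb{Q}(\alpha,\beta,\gamma)\subset\mathbb{R}$. Then $\mathrm{CF}(l_1,l_2,l_3,l_4)$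 has a proper palindromic symmetry if and only if the embeddings of $K$ into $\mathbb{R}$ can be listed, each exactly once, as $\sigma_1=\mathrm{id},\sigma_2,\sigma_3,\sigma_4$ in such a way that $$\sigma_3(K)=K,\quad \sigma_4(K)=\sigma_2(K),\quad \sigma_3^2=\mathrm{id},\quad \sigma_4=\sigma_2\sigma_3,$$ and there are algebraic numbers $\omega,\psi\in K$ of degree $4$ for which, with $\omega'=\sigma_3(\omega)$ and $\psi'=\sigma_3(\psi)$, at least one of the following holds: (1) $(1,\alpha,\beta,\gamma)\sim(1,\omega,\psi,\omega')$ and $\psi+\psi'=-(\omega+\omega')$; (2) $(1,\alpha,\beta,\gamma)\sim(1,\omega,\psi,\omega')$ and $\psi+\psi'=1-(\omega+\omega')$; (3) $(1,\alpha,\beta,\gamma)\sim(1,\omega,\psi,\omega')$ and $\psi+\psi'=2-(\omega+\omega')$; (4) $(1,\alpha,\beta,\gamma)\sim(1,\omega,\psi,\frac{\omega+\omega'}{2})$ and $\psi+\psi'=-(\omega+\omega')$; (5) $(1,\alpha,\beta,\gamma)\sim(1,\omega,\psi,\frac{\omega+\omega'}{2})$ and $\psi+\psi'=2-(\omega+\omega')$;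 (6) $(1,\alpha,\beta,\gamma)\sim(1,\omega,\psi,\frac{\omega+\omega'+1}{2})$ and $\psi+\psi'=-(\omega+\omega')$; (7) $(1,\alpha,\beta,\gamma)\sim(1,\omega,\psi,\frac{\omega+\omega'+1}{2})$ and $\psi+\psi'=2-(\omega+\omega')$; (8) $(1,\alpha,\beta,\gamma)\sim(1,\omega,\psi,\frac{\omega+\omega'}{2})$ and $\psi+\psi'=1-\frac{\omega+\omega'}{2}$; (9) $(1,\alpha,\beta,\gamma)\sim(1,\omega,\psi,\frac{\omega+\omega'}{2})$ and $\psi+\psi'=2-\frac{\omega+\omega'}{2}$; (10) $(1,\alpha,\beta,\gamma)\sim(1,\omega,\psi,\frac{\omega'-\omega}{4})$ and $\psi+\psi'=2-\frac{\omega+\omega'}{2}$. -/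

import Mathlib

open scoped MatrixGroups Matrix

noncomputable section

namespace KleinCF

/-- The action of an operator of `GL_n(ℤ)` on `ℝⁿ` (by its matrix in the standard basis). -/
def act {n : ℕ} (G : GL (Fin n) ℤ) : (Fin n → ℝ) →ₗ[ℝ] (Fin n → ℝ) :=
  Matrix.toLin' ((G : Matrix (Fin n) (Fin n) ℤ).map (Int.castRingHom ℝ))

/-- The integer points of `ℝⁿ`. -/
def integerPoints (n : ℕ) : Set (Fin n → ℝ) :=
  Set.range fun z : Fin n → ℤ => fun i => (z i : ℝ)

/-- The set `𝒞(l₁, …, lₙ)` of the simplicial cones into which the hyperplanes spanned by the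
`(n - 1)`-tuples of the lines `l₁, …, lₙ` split `ℝⁿ`: each cone is generated by one
half-line on each of the lines. -/
def cones {n : ℕ} (l : Fin n → Submodule ℝ (Fin n → ℝ)) : Set (Set (Fin n → ℝ)) :=
  {C | ∃ v : Fin n → (Fin n → ℝ), (∀ i, l i = Submodule.span ℝ {v i}) ∧
    C = {x | ∃ c : Fin n → ℝ, (∀ i, 0 ≤ c i) ∧ x = ∑ i, c i • v i}}

/-- The Klein polyhedron of a cone: the convex hull of its nonzero integer points. -/
def kleinPolyhedron {n : ℕ} (C : Set (Fin n → ℝ)) : Set (Fin n → ℝ) :=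
  convexHull ℝ ((C ∩ integerPoints n) \ {0})

/-- The Klein sail of a cone: the boundary of its Klein polyhedron. -/
def sail {n : ℕ} (C : Set (Fin n → ℝ)) : Set (Fin n → ℝ) :=
  frontier (kleinPolyhedron C)

/-- The `(n - 1)`-dimensional continued fraction `CF(l₁, …, lₙ)`: the union of all sails. -/
def CF {n : ℕ} (l : Fin n → Submodule ℝ (Fin n → ℝ)) : Set (Fin n → ℝ) :=
  ⋃ C ∈ cones l, sail C

/-- A hyperbolic operator: an element of `GL_n(ℤ)` all of whose eigenvalues are real and whose
characteristic polynomial is irreducible over `ℚ`. -/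
def IsHyperbolic {n : ℕ} (A : GL (Fin n) ℤ) : Prop :=
  Irreducible ((A : Matrix (Fin n) (Fin n) ℤ).map (Int.castRingHom ℚ)).charpoly ∧
    ((A : Matrix (Fin n) (Fin n) ℤ).map (Int.castRingHom ℝ)).charpoly.Splits

/-- `l₁, …, lₙ` are the eigenlines of a hyperbolic operator, that is, `CF(l₁, …, lₙ)` is an
algebraic continued fraction. -/
def IsAlgebraicCF {n : ℕ} (l : Fin n → Submodule ℝ (Fin n → ℝ)) : Prop :=
  ∃ A : GL (Fin n) ℤ, IsHyperbolic A ∧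
    ∃ μ : Fin n → ℝ, Function.Injective μ ∧
      ∀ i, Module.End.HasEigenvalue (act A) (μ i) ∧ l i = Module.End.eigenspace (act A) (μ i)

/-- `G` belongs to the symmetry group of the continued fraction. -/
def IsSymmetry {n : ℕ} (l : Fin n → Submodule ℝ (Fin n → ℝ)) (G : GL (Fin n) ℤ) : Prop :=
  act G '' CF l = CF l

/-- A Dirichlet symmetry: a symmetry that maps each of the lines `l₁, …, lₙ` to itself. -/
def IsDirichletSymmetry {n : ℕ} (l : Fin n → Submodule ℝ (Fin n → ℝ)) (G : GL (Fin n) ℤ) : Prop :=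
  IsSymmetry l G ∧ ∀ i, (l i).map (act G) = l i

/-- A palindromic symmetry: a symmetry that is not a Dirichlet symmetry. -/
def IsPalindromicSymmetry {n : ℕ} (l : Fin n → Submodule ℝ (Fin n → ℝ)) (G : GL (Fin n) ℤ) :
    Prop :=
  IsSymmetry l G ∧ ¬ IsDirichletSymmetry l G

/-- A proper palindromic symmetry: one with a fixed point on some sail. -/
def IsProperPalindromicSymmetry {n : ℕ} (l : Fin n → Submodule ℝ (Fin n → ℝ))
    (G : GL (Fin n) ℤ) : Prop :=
  IsPalindromicSymmetry l G ∧ ∃ C ∈ cones l, ∃ p ∈ sail C, act G p = p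

/-- `v ∼ w`: some operator of `GL_n(ℤ)` maps `v` to a nonzero real multiple of `w`. -/
def Equivalent {n : ℕ} (v w : Fin n → ℝ) : Prop :=
  ∃ X : GL (Fin n) ℤ, ∃ μ : ℝ, μ ≠ 0 ∧ act X v = μ • w

/-- At least one of the ten relations holds for the vector `v` and the numbers `ω`, `ψ` with
their images `ω'`, `ψ'`. -/
def TenRelations (v : Fin 4 → ℝ) (ω ψ ω' ψ' : ℝ) : Prop :=
  (Equivalent v ![1, ω, ψ, ω'] ∧ ψ + ψ' = -(ω + ω')) ∨
  (Equivalent v ![1, ω, ψ, ω'] ∧ ψ + ψ' = 1 - (ω + ω')) ∨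
  (Equivalent v ![1, ω, ψ, ω'] ∧ ψ + ψ' = 2 - (ω + ω')) ∨
  (Equivalent v ![1, ω, ψ, (ω + ω') / 2] ∧ ψ + ψ' = -(ω + ω')) ∨
  (Equivalent v ![1, ω, ψ, (ω + ω') / 2] ∧ ψ + ψ' = 2 - (ω + ω')) ∨
  (Equivalent v ![1, ω, ψ, (ω + ω' + 1) / 2] ∧ ψ + ψ' = -(ω + ω')) ∨
  (Equivalent v ![1, ω, ψ, (ω + ω' + 1) / 2] ∧ ψ + ψ' = 2 - (ω + ω')) ∨
  (Equivalent v ![1, ω, ψ, (ω + ω') / 2] ∧ ψ + ψ' = 1 - (ω + ω') / 2) ∨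
  (Equivalent v ![1, ω, ψ, (ω + ω') / 2] ∧ ψ + ψ' = 2 - (ω + ω') / 2) ∨
  (Equivalent v ![1, ω, ψ, (ω' - ω) / 4] ∧ ψ + ψ' = 2 - (ω + ω') / 2)

/-- For embeddings `σ₂, σ₃, σ₄` of a field `K ⊆ ℝ` into `ℝ`: `σ₃(K) = K`, `σ₄(K) = σ₂(K)`,
`σ₃² = id` and `σ₄ = σ₂σ₃`. The compositions are written with `τ`, which is `σ₃` regarded as
a map from `K` to `K`. -/
def EmbeddingConditions (K : IntermediateField ℚ ℝ) (σ₂ σ₃ σ₄ : K →ₐ[ℚ] ℝ) : Prop :=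
  σ₃.fieldRange = K ∧ σ₄.fieldRange = σ₂.fieldRange ∧
    ∃ τ : K →ₐ[ℚ] K, K.val.comp τ = σ₃ ∧ τ.comp τ = AlgHom.id ℚ K ∧ σ₄ = σ₂.comp τ

end KleinCF

end

open scoped MatrixGroups Matrix

namespace KleinCF

/-! ### Eigenbases and the product of coordinates at integer points. -/

section

open Module

/-! Geometry is turned into field arithmetic, and that into a classification of integer involutions.

Geometry: the product of the eigencoordinates of a nonzero integer point is bounded away from zero
(`normBounded_of_eigenbasis`), so sails stay off the hyperplanes spanned by the lines, while every
ray off these hyperplanes meets a sail. Hence `CF` determines the union of the hyperplanes, and a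
symmetry permutes them. If the symmetry also fixes a point of a sail, scaling the generators so that
this point is their sum makes it permute the generators themselves (`exists_permutes_of_fixed`).
Conversely, an integer operator permuting generators nontrivially fixes their sum, hence a point of
a sail (`isProperPalindromicSymmetry_of_permutes`).

Arithmetic: the numbers `1, α, β, γ` form a `ℚ`-basis of `K`, and the four lines are spanned by its
conjugates (`exists_conjugates`). An operator permuting generators therefore acts on this basis as
an automorphism `τ` of `K` followed by multiplication by an element of `K`
(`exists_algHom_of_permutes`). A nontrivial permutation arising so has no fixed index; it or its
square is a fixed point free involution, represented by an integer matrix of square one and trace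
zero.

Classification: up to integer conjugation there are only three such matrices
(`exists_conjugate_involution`). In a suitable integer basis they give relations (1), (2) and (4), a
shear making `ω` and `ψ` of degree four. For the converse, each of the ten relations says that `τ`
preserves the lattice spanned by the four numbers; the matrix of `τ` on it, carried back to the
original coordinates, is the required symmetry. -/

/-- The cone generated by a family of vectors. -/
def coneOf {n : ℕ} (v : Fin n → (Fin n → ℝ)) : Set (Fin n → ℝ) :=
  {x | ∃ c : Fin n → ℝ, (∀ i, 0 ≤ c i) ∧ x = ∑ i, c i • v i}

theorem mem_coneOf_basis {n : ℕ} (b : Basis (Fin n) ℝ (Fin n → ℝ)) (x : Fin n → ℝ) :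
    x ∈ coneOf b ↔ ∀ i, 0 ≤ b.repr x i := by
  constructor
  · rintro ⟨c, hc, rfl⟩ i
    rw [b.repr_sum_self]
    exact hc i
  · intro h
    exact ⟨fun i => b.repr x i, h, (b.sum_repr x).symm⟩

theorem mem_cones_iff {n : ℕ} {l : Fin n → Submodule ℝ (Fin n → ℝ)} {C : Set (Fin n → ℝ)} :
    C ∈ cones l ↔ ∃ v : Fin n → (Fin n → ℝ), (∀ i, l i = Submodule.span ℝ {v i}) ∧
      C = coneOf v := Iff.rfl

/-- The real vector with the coordinates of an integer vector. -/
def toReal {n : ℕ} (z : Fin n → ℤ) : Fin n → ℝ := fun i => (z i : ℝ)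

theorem act_toReal {n : ℕ} (G : GL (Fin n) ℤ) (z : Fin n → ℤ) :
    act G (toReal z) = toReal ((G : Matrix (Fin n) (Fin n) ℤ) *ᵥ z) := by
  ext i
  simp [act, toReal, Matrix.mulVec, dotProduct]

theorem act_mul {n : ℕ} (G H : GL (Fin n) ℤ) : act (G * H) = act G ∘ₗ act H := by
  simp only [act, Units.val_mul, Matrix.map_mul, Matrix.toLin'_mul]

theorem act_one {n : ℕ} : act (1 : GL (Fin n) ℤ) = LinearMap.id := by
  simp [act, Matrix.map_one]

theorem eq_of_act_eq {n : ℕ} {G H : GL (Fin n) ℤ} (h : act G = act H) : G = H := by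
  have h2 := (Matrix.toLin' (R := ℝ)).injective h
  apply Units.ext
  ext i j
  have := congrFun (congrFun h2 i) j
  simpa using this

theorem act_act_inv {n : ℕ} (G : GL (Fin n) ℤ) (x : Fin n → ℝ) : act G (act G⁻¹ x) = x := by
  rw [← LinearMap.comp_apply, ← act_mul, mul_inv_cancel, act_one, LinearMap.id_apply]

/-- The bases for which the product of the coordinates of nonzero integer vectors is bounded
away from zero. -/
def NormBounded {n : ℕ} (b : Basis (Fin n) ℝ (Fin n → ℝ)) : Prop :=
  ∃ δ > 0, ∀ z : Fin n → ℤ, z ≠ 0 → δ ≤ |∏ i, b.repr (toReal z) i|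

theorem toReal_pow_mulVec {n : ℕ} {A : GL (Fin n) ℤ} {b : Basis (Fin n) ℝ (Fin n → ℝ)}
    {μ : Fin n → ℝ} (h : ∀ i, act A (b i) = μ i • b i) (z : Fin n → ℤ) (k : ℕ) :
    toReal (((A : Matrix (Fin n) (Fin n) ℤ) ^ k) *ᵥ z) =
      ∑ j, (b.repr (toReal z) j * μ j ^ k) • b j := by
  induction k with
  | zero => simp
  | succ k ih =>
    rw [pow_succ', ← Matrix.mulVec_mulVec, ← act_toReal, ih, map_sum]
    refine Finset.sum_congr rfl fun j _ => ?_
    rw [map_smul, h, smul_smul, pow_succ, mul_assoc]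

theorem aeval_eq_zero_of_hasEigenvalue {n : ℕ} {A : GL (Fin n) ℤ} {μ : ℝ}
    (h : Module.End.HasEigenvalue (act A) μ) :
    Polynomial.aeval μ ((A : Matrix (Fin n) (Fin n) ℤ).map (Int.castRingHom ℚ)).charpoly = 0 := by
  rw [Module.End.hasEigenvalue_iff_isRoot_charpoly] at h
  have h1 : (act A).charpoly = (((A : Matrix (Fin n) (Fin n) ℤ).map
      (Int.castRingHom ℚ)).map (algebraMap ℚ ℝ)).charpoly := by
    rw [act, ← Matrix.toLin_eq_toLin', Matrix.charpoly_toLin]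
    congr 1
  rw [h1, Matrix.charpoly_map, Polynomial.IsRoot, Polynomial.eval_map_algebraMap] at h
  exact h

theorem minpoly_of_isHyperbolic {n : ℕ} {A : GL (Fin n) ℤ} (hA : IsHyperbolic A) {μ : ℝ}
    (h : Module.End.HasEigenvalue (act A) μ) :
    minpoly ℚ μ = ((A : Matrix (Fin n) (Fin n) ℤ).map (Int.castRingHom ℚ)).charpoly :=
  (minpoly.eq_of_irreducible_of_monic hA.1 (aeval_eq_zero_of_hasEigenvalue h)
    (Matrix.charpoly_monic _)).symm

theorem natDegree_minpoly_of_isHyperbolic {n : ℕ} {A : GL (Fin n) ℤ} (hA : IsHyperbolic A) {μ : ℝ}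
    (h : Module.End.HasEigenvalue (act A) μ) : (minpoly ℚ μ).natDegree = n := by
  rw [minpoly_of_isHyperbolic hA h, Matrix.charpoly_natDegree_eq_dim, Fintype.card_fin]

/-- The matrix with columns `A ^ k *ᵥ z`, `k < n`, has an integer determinant, equal to the product
of the coordinates of `z` times a constant `D` independent of `z`. It is nonzero: a relation between
the columns gives a nonzero rational polynomial of degree below `n` that vanishes at each `μ j` with
nonzero coordinate, although `μ j` has degree `n`. -/
theorem normBounded_of_eigenbasis {n : ℕ} {A : GL (Fin n) ℤ} (hA : IsHyperbolic A)
    {b : Basis (Fin n) ℝ (Fin n → ℝ)} {μ : Fin n → ℝ} (hμ : Function.Injective μ)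
    (h : ∀ i, act A (b i) = μ i • b i) : NormBounded b := by
  set V : Matrix (Fin n) (Fin n) ℝ := Matrix.of fun i j => b j i
  set D : ℝ := V.det * (Matrix.vandermonde μ).det
  have hkey : ∀ z : Fin n → ℤ, z ≠ 0 → 1 ≤ |D| * |∏ i, b.repr (toReal z) i| := by
    intro z hz
    set M : Matrix (Fin n) (Fin n) ℤ :=
      Matrix.of fun i (k : Fin n) => (((A : Matrix (Fin n) (Fin n) ℤ) ^ (k : ℕ)) *ᵥ z) i
    have hM : M.map (Int.castRingHom ℝ) =
        V * Matrix.diagonal (fun i => b.repr (toReal z) i) * Matrix.vandermonde μ := by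
      ext i k
      have h1 := congrFun (toReal_pow_mulVec h z k) i
      rw [Matrix.mul_apply]
      simp only [Matrix.mul_diagonal]
      have h2 : (M.map (Int.castRingHom ℝ)) i k =
        toReal (((A : Matrix (Fin n) (Fin n) ℤ) ^ (k : ℕ)) *ᵥ z) i := rfl
      rw [h2, h1, Finset.sum_apply]
      refine Finset.sum_congr rfl fun j _ => ?_
      simp [V, Matrix.vandermonde]
      ring
    have hdet : ((M.det : ℤ) : ℝ) = D * ∏ i, b.repr (toReal z) i := by
      have h3 : ((M.det : ℤ) : ℝ) = (M.map (Int.castRingHom ℝ)).det := by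
        rw [← RingHom.mapMatrix_apply, ← RingHom.map_det]; simp
      rw [h3, hM, Matrix.det_mul, Matrix.det_mul, Matrix.det_diagonal]
      ring
    have hne : M.det ≠ 0 := by
      intro h0
      obtain ⟨a, ha, hMa⟩ := Matrix.exists_mulVec_eq_zero_iff.mpr h0
      apply hz
      have hsum : ∀ j, b.repr (toReal z) j * ∑ k : Fin n, μ j ^ (k : ℕ) * (a k : ℝ) = 0 := by
        have h4 : ∑ k : Fin n, (a k : ℝ) •
            toReal (((A : Matrix (Fin n) (Fin n) ℤ) ^ (k : ℕ)) *ᵥ z) = 0 := by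
          ext i
          have := congrFun hMa i
          simp only [Matrix.mulVec, dotProduct, Pi.zero_apply] at this
          have h5 : ((∑ k, M i k * a k : ℤ) : ℝ) = 0 := by rw [this]; simp
          push_cast at h5
          rw [Finset.sum_apply, Pi.zero_apply, ← h5]
          refine Finset.sum_congr rfl fun k _ => ?_
          simp only [Pi.smul_apply, smul_eq_mul, toReal, M, Matrix.of_apply]
          ring
        intro j
        have h6 := congrArg (fun x => b.repr x j) h4
        simp only [toReal_pow_mulVec h, map_sum, map_smul, Finsupp.coe_finsetSum,
          Finset.sum_apply, Finsupp.smul_apply, map_zero, Finsupp.coe_zero, Pi.zero_apply,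
          Basis.repr_self, smul_eq_mul] at h6
        rw [← h6, Finset.mul_sum]
        refine Finset.sum_congr rfl fun k _ => ?_
        rw [Finset.sum_eq_single j]
        · simp; ring
        · intro i _ hij; simp [hij]
        · simp
      have hcoord : ∀ j, b.repr (toReal z) j = 0 := by
        intro j
        rcases mul_eq_zero.mp (hsum j) with h7 | h7
        · exact h7
        exfalso
        have hev : Module.End.HasEigenvalue (act A) (μ j) :=
          Module.End.hasEigenvalue_of_hasEigenvector
            ⟨Module.End.mem_eigenspace_iff.mpr (h j), b.ne_zero j⟩
        set q : Polynomial ℚ := ∑ k : Fin n, Polynomial.C (a k : ℚ) * Polynomial.X ^ (k : ℕ)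
        have hq0 : Polynomial.aeval (μ j) q = 0 := by
          simp only [q, map_sum, map_mul, Polynomial.aeval_C, map_pow, Polynomial.aeval_X]
          rw [← h7]
          refine Finset.sum_congr rfl fun k _ => ?_
          simp; ring
        have hqne : q ≠ 0 := by
          intro hq
          apply ha
          funext k
          have := congrArg (fun p => Polynomial.coeff p (k : ℕ)) hq
          simp only [q, Polynomial.finsetSum_coeff, Polynomial.coeff_C_mul_X_pow,
            Polynomial.coeff_zero] at this
          rw [Finset.sum_eq_single k] at this
          · simpa using this
          · intro i _ hik
            rw [if_neg]; intro hh; exact hik (Fin.ext hh.symm)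
          · simp
        have hdeg : q.degree < (n : ℕ) := by
          rw [Polynomial.degree_lt_iff_coeff_zero]
          intro m hm
          simp only [q, Polynomial.finsetSum_coeff, Polynomial.coeff_C_mul_X_pow]
          refine Finset.sum_eq_zero fun k _ => if_neg ?_
          have := k.2
          omega
        have hle := Polynomial.natDegree_le_of_dvd (minpoly.dvd ℚ (μ j) hq0) hqne
        rw [natDegree_minpoly_of_isHyperbolic hA hev] at hle
        have := (Polynomial.natDegree_lt_iff_degree_lt hqne).mpr hdeg
        omega
      have hz0 : toReal z = 0 := by
        apply b.repr.injective
        ext j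
        simpa using hcoord j
      funext i
      have := congrFun hz0 i
      simpa [toReal] using this
    rw [← abs_mul, ← hdet]
    exact_mod_cast Int.one_le_abs hne
  rcases Nat.eq_zero_or_pos n with rfl | hn
  · exact ⟨1, one_pos, fun z hz => absurd (Subsingleton.elim _ _) hz⟩
  -- That `D ≠ 0` follows from `hkey` at any nonzero integer vector, here the all-ones one.
  have hD : 0 < |D| := by
    have hz : (fun _ : Fin n => (1 : ℤ)) ≠ 0 := by
      intro h0
      exact one_ne_zero (congrFun h0 ⟨0, hn⟩)
    rcases (abs_nonneg D).eq_or_lt with h0 | h0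
    · have := hkey _ hz
      rw [← h0] at this
      linarith
    · exact h0
  refine ⟨1 / |D|, by positivity, fun z hz => ?_⟩
  rw [div_le_iff₀ hD, mul_comm]
  exact hkey z hz

/-- The generators may be scaled and oriented at will; this freedom is what lets one choose a cone,
or turn a given point into the sum of the generators. -/
theorem exists_basis_of_isAlgebraicCF {n : ℕ} {l : Fin n → Submodule ℝ (Fin n → ℝ)}
    (hl : IsAlgebraicCF l) {v : Fin n → (Fin n → ℝ)}
    (hv : ∀ i, l i = Submodule.span ℝ {v i}) :
    ∃ b : Basis (Fin n) ℝ (Fin n → ℝ), (∀ i, b i = v i) ∧ NormBounded b := by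
  obtain ⟨A, hA, μ, hμ, h⟩ := hl
  have hmem : ∀ i, act A (v i) = μ i • v i := by
    intro i
    rw [← Module.End.mem_eigenspace_iff, ← (h i).2, hv i]
    exact Submodule.mem_span_singleton_self _
  have hne : ∀ i, v i ≠ 0 := by
    intro i h0
    have h1 := (h i).1
    rw [Module.End.HasEigenvalue, Module.End.HasUnifEigenvalue, ← Module.End.eigenspace, ← (h i).2, hv i, h0] at h1
    simp at h1
  have hli : LinearIndependent ℝ v :=
    Module.End.eigenvectors_linearIndependent' (act A) μ hμ v
      fun i => ⟨Module.End.mem_eigenspace_iff.mpr (hmem i), hne i⟩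
  rcases Nat.eq_zero_or_pos n with rfl | hn
  · refine ⟨Pi.basisFun ℝ (Fin 0), fun i => i.elim0, 1, one_pos, fun z hz => ?_⟩
    exact absurd (Subsingleton.elim _ _) hz
  have : Nonempty (Fin n) := ⟨⟨0, hn⟩⟩
  let b := basisOfLinearIndependentOfCardEqFinrank hli (by simp)
  have hb : ∀ i, b i = v i := fun i => by simp [b]
  exact ⟨b, hb, normBounded_of_eigenbasis hA hμ fun i => by rw [hb, hmem]⟩

end

/-! ### Sails and the rays that meet them. -/

section

open Module

/-- On the positive orthant the logarithm of the product is a sum of concave functions. -/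
theorem convex_prod_ge {ι : Type*} [Fintype ι] {δ : ℝ} (hδ : 0 < δ) :
    Convex ℝ {c : ι → ℝ | (∀ i, 0 < c i) ∧ δ ≤ ∏ i, c i} := by
  rintro c ⟨hc, hcδ⟩ d ⟨hd, hdδ⟩ r s hr hs hrs
  have hpos : ∀ i, 0 < r * c i + s * d i := by
    intro i
    rcases hr.eq_or_lt with h | h
    · have : s = 1 := by linarith
      subst this
      simpa [← h] using hd i
    · have := mul_pos h (hc i)
      have := mul_nonneg hs (hd i).le
      linarith
  refine ⟨hpos, ?_⟩
  have hlog : ∀ e : ι → ℝ, (∀ i, 0 < e i) → Real.log (∏ i, e i) = ∑ i, Real.log (e i) :=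
    fun e he => Real.log_prod fun i _ => (he i).ne'
  have hP : 0 < ∏ i, (r • c + s • d) i := Finset.prod_pos fun i _ => hpos i
  rw [← Real.log_le_log_iff hδ hP, hlog (r • c + s • d) hpos]
  have h1 := Real.log_le_log hδ hcδ
  have h2 := Real.log_le_log hδ hdδ
  rw [hlog _ hc] at h1
  rw [hlog _ hd] at h2
  calc Real.log δ = r * Real.log δ + s * Real.log δ := by rw [← add_mul, hrs, one_mul]
    _ ≤ r * ∑ i, Real.log (c i) + s * ∑ i, Real.log (d i) := by gcongr
    _ = ∑ i, (r * Real.log (c i) + s * Real.log (d i)) := by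
      rw [Finset.mul_sum, Finset.mul_sum, Finset.sum_add_distrib]
    _ ≤ ∑ i, Real.log ((r • c + s • d) i) := Finset.sum_le_sum fun i _ =>
      strictConcaveOn_log_Ioi.concaveOn.2 (hc i) (hd i) hr hs hrs

/-- A product of at least `δ > 0` has no zero factor, so the strict inequalities may be replaced by
weak ones. -/
theorem isClosed_prod_ge {ι : Type*} [Fintype ι] {δ : ℝ} (hδ : 0 < δ) :
    IsClosed {c : ι → ℝ | (∀ i, 0 < c i) ∧ δ ≤ ∏ i, c i} := by
  have : {c : ι → ℝ | (∀ i, 0 < c i) ∧ δ ≤ ∏ i, c i} =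
      (⋂ i, {c : ι → ℝ | 0 ≤ c i}) ∩ {c | δ ≤ ∏ i, c i} := by
    ext c
    simp only [Set.mem_ofPred_eq, Set.mem_inter_iff, Set.mem_iInter]
    refine ⟨fun h => ⟨fun i => (h.1 i).le, h.2⟩, fun h => ⟨fun i => (h.1 i).lt_of_ne ?_, h.2⟩⟩
    intro h0
    rw [Finset.prod_eq_zero (Finset.mem_univ i) h0.symm] at h
    linarith [h.2]
  rw [this]
  exact (isClosed_iInter fun i => isClosed_le continuous_const (continuous_apply i)).inter
    (isClosed_le continuous_const (continuous_finsetProd _ fun i _ => continuous_apply i))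

/-- The nonzero integer points of the cone lie in the closed convex region where the coordinates are
positive with product at least `δ`; so does the closure of their hull. -/
theorem closure_kleinPolyhedron_pos {n : ℕ} {b : Basis (Fin n) ℝ (Fin n → ℝ)}
    (hb : NormBounded b) {x : Fin n → ℝ} (hx : x ∈ closure (kleinPolyhedron (coneOf b)))
    (i : Fin n) : 0 < b.repr x i := by
  obtain ⟨δ, hδ, hz⟩ := hb
  have hsub : kleinPolyhedron (coneOf b) ⊆
      b.equivFun ⁻¹' {c : Fin n → ℝ | (∀ i, 0 < c i) ∧ δ ≤ ∏ i, c i} := by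
    refine convexHull_min ?_ ((convex_prod_ge hδ).linear_preimage b.equivFun.toLinearMap)
    rintro y ⟨⟨hyC, z, rfl⟩, hy0⟩
    have hz0 : z ≠ 0 := by
      rintro rfl
      apply hy0
      ext i
      simp
    have h1 : ∀ i, 0 ≤ b.repr (toReal z) i := (mem_coneOf_basis b _).mp hyC
    have h2 := hz z hz0
    rw [abs_of_nonneg (Finset.prod_nonneg fun i _ => h1 i)] at h2
    refine ⟨fun i => (h1 i).lt_of_ne fun h0 => ?_, h2⟩
    rw [Finset.prod_eq_zero (Finset.mem_univ i) h0.symm] at h2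
    linarith
  have hcl : IsClosed (b.equivFun ⁻¹' {c : Fin n → ℝ | (∀ i, 0 < c i) ∧ δ ≤ ∏ i, c i}) :=
    (isClosed_prod_ge hδ).preimage b.equivFun.toLinearMap.continuous_of_finiteDimensional
  exact (closure_minimal hsub hcl hx).1 i

theorem sail_pos {n : ℕ} {b : Basis (Fin n) ℝ (Fin n → ℝ)}
    (hb : NormBounded b) {x : Fin n → ℝ} (hx : x ∈ sail (coneOf b)) (i : Fin n) :
    0 < b.repr x i :=
  closure_kleinPolyhedron_pos hb (frontier_subset_closure hx) i

/-- A point with positive coordinates has a multiple in the Klein polyhedron. -/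
theorem exists_smul_mem_kleinPolyhedron {n : ℕ} [NeZero n] (b : Basis (Fin n) ℝ (Fin n → ℝ))
    {x : Fin n → ℝ} (hx : ∀ i, 0 < b.repr x i) :
    ∃ T : ℝ, T • x ∈ kleinPolyhedron (coneOf b) := by
  obtain ⟨M, hM⟩ : ∃ M : ℝ, ∀ i, ∀ y : Fin n → ℝ, |b.repr y i| ≤ M * ‖y‖ := by
    let f := b.equivFun.toLinearMap.toContinuousLinearMap
    refine ⟨‖f‖, fun i y => ?_⟩
    calc |b.repr y i| = ‖f y i‖ := rfl
      _ ≤ ‖f y‖ := norm_le_pi_norm _ _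
      _ ≤ ‖f‖ * ‖y‖ := f.le_opNorm y
  have hM0 : 0 ≤ M := by
    by_contra h
    have h1 := hM 0 (fun _ => 1)
    have h2 : ‖(fun _ => 1 : Fin n → ℝ)‖ = 1 := by
      rw [pi_norm_const]; simp
    rw [h2] at h1
    linarith [abs_nonneg (b.repr (fun _ => 1) (0 : Fin n))]
  -- Summing over all `i` gives one `T` that is large enough for every coordinate.
  obtain ⟨T, hT0, hT⟩ : ∃ T : ℝ, 0 < T ∧ ∀ i, M < T * b.repr x i := by
    refine ⟨∑ i, (M + 1) / b.repr x i, Finset.sum_pos (fun i _ => div_pos (by linarith) (hx i))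
      Finset.univ_nonempty, fun i => ?_⟩
    have h1 : (M + 1) / b.repr x i ≤ ∑ i, (M + 1) / b.repr x i :=
      Finset.single_le_sum (f := fun i => (M + 1) / b.repr x i)
        (fun j _ => (div_pos (by linarith) (hx j)).le) (Finset.mem_univ i)
    calc M < M + 1 := by linarith
      _ = (M + 1) / b.repr x i * b.repr x i := by field_simp [(hx i).ne']
      _ ≤ _ := mul_le_mul_of_nonneg_right h1 (hx i).le
  refine ⟨T, ?_⟩
  set y := T • x
  -- `y` lies in the unit cube with integer vertices around it. The vertices are within distance one
  -- of `y` in the sup norm, so their coordinates differ from those of `y` by at most `M` and remain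
  -- positive.
  set t : Fin n → Set ℝ := fun j => {((⌊y j⌋ : ℤ) : ℝ), ((⌊y j⌋ + 1 : ℤ) : ℝ)}
  have hy : y ∈ convexHull ℝ (Set.univ.pi t) := by
    apply mem_convexHull_pi
    intro j _
    rw [convexHull_pair, segment_eq_Icc (by push_cast; linarith)]
    exact ⟨Int.floor_le _, by push_cast; exact (Int.lt_floor_add_one _).le⟩
  refine convexHull_mono ?_ hy
  intro u hu
  have hint : ∀ j, ∃ z : ℤ, u j = z ∧ |u j - y j| ≤ 1 := by
    intro j
    have h1 := Int.floor_le (y j)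
    have h2 := Int.lt_floor_add_one (y j)
    rcases hu j (Set.mem_univ j) with h | h
    · refine ⟨_, h, ?_⟩
      rw [h, abs_le]
      constructor <;> linarith
    · rw [Set.mem_singleton_iff] at h
      refine ⟨_, h, ?_⟩
      rw [h, abs_le]
      push_cast
      constructor <;> linarith
  have hnorm : ‖u - y‖ ≤ 1 := (pi_norm_le_iff_of_nonneg zero_le_one).mpr fun j => by
    obtain ⟨z, _, hz⟩ := hint j
    exact hz
  have hpos : ∀ i, 0 < b.repr u i := by
    intro i
    have h1 := (hM i (u - y)).trans (mul_le_of_le_one_right hM0 hnorm)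
    have h2 := (abs_le.mp h1).1
    have h3 := hT i
    simp only [map_sub, Finsupp.coe_sub, Pi.sub_apply, y, map_smul, Finsupp.smul_apply,
      smul_eq_mul] at h2
    linarith
  refine ⟨⟨(mem_coneOf_basis b u).mpr fun i => (hpos i).le, ?_⟩, ?_⟩
  · choose z hz _ using hint
    exact ⟨z, funext fun j => (hz j).symm⟩
  · intro h0
    rw [Set.mem_singleton_iff] at h0
    have := hpos 0
    simp [h0] at this

/-- The line through `x` meets the Klein polyhedron but is not contained in it, since it passes
through `0`; a boundary point of the intersection is on the sail. Positivity of coordinates on the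
sail forces `t > 0`. -/
theorem exists_smul_mem_sail {n : ℕ} [NeZero n] {b : Basis (Fin n) ℝ (Fin n → ℝ)}
    (hb : NormBounded b) {x : Fin n → ℝ} (hx : ∀ i, 0 < b.repr x i) :
    ∃ t : ℝ, 0 < t ∧ t • x ∈ sail (coneOf b) := by
  set S : Set ℝ := (fun t : ℝ => t • x) ⁻¹' kleinPolyhedron (coneOf b)
  have h1 : (frontier S).Nonempty := by
    rw [nonempty_frontier_iff]
    refine ⟨exists_smul_mem_kleinPolyhedron b hx, fun h => ?_⟩
    have h0 : (0 : ℝ) ∈ S := h ▸ Set.mem_univ _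
    have := closure_kleinPolyhedron_pos hb (subset_closure h0) 0
    simp at this
  obtain ⟨t, ht⟩ := h1
  have hcont : Continuous fun t : ℝ => t • x := by fun_prop
  have ht2 : t • x ∈ sail (coneOf b) := hcont.frontier_preimage_subset _ ht
  refine ⟨t, ?_, ht2⟩
  have := sail_pos hb ht2 0
  rw [map_smul, Finsupp.smul_apply, smul_eq_mul] at this
  exact pos_of_mul_pos_left this (hx 0).le

/-- The points off the hyperplanes spanned by the lines are those whose ray meets `CF`. -/
theorem repr_ne_zero_iff_exists_smul_mem_CF {n : ℕ} [NeZero n]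
    {l : Fin n → Submodule ℝ (Fin n → ℝ)} (hl : IsAlgebraicCF l)
    {b : Basis (Fin n) ℝ (Fin n → ℝ)} (hb : ∀ i, l i = Submodule.span ℝ {b i})
    (x : Fin n → ℝ) : (∀ i, b.repr x i ≠ 0) ↔ ∃ t : ℝ, 0 < t ∧ t • x ∈ CF l := by
  constructor
  · intro hx
    -- The generators of the cone containing `x` in its interior, scaled so that `x` is their sum.
    let v : Fin n → (Fin n → ℝ) := fun i => b.repr x i • b i
    have hv : ∀ i, l i = Submodule.span ℝ {v i} := fun i => by
      rw [hb, Submodule.span_singleton_smul_eq (IsUnit.mk0 _ (hx i))]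
    obtain ⟨b', hb', hN⟩ := exists_basis_of_isAlgebraicCF hl hv
    have hbv : v = b' := (funext hb').symm
    have hx' : ∀ i, b'.repr x i = 1 := by
      intro i
      have : x = ∑ i, (1 : ℝ) • b' i := by
        simp only [hb', v, one_smul]
        exact (b.sum_repr x).symm
      rw [this, b'.repr_sum_self]
    obtain ⟨t, ht, hs⟩ := exists_smul_mem_sail hN (x := x) fun i => by rw [hx']; exact one_pos
    exact ⟨t, ht, Set.mem_biUnion (mem_cones_iff.mpr ⟨v, hv, rfl⟩) (hbv ▸ hs)⟩
  · rintro ⟨t, ht, hC⟩ i h0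
    obtain ⟨C, ⟨v, hv, rfl⟩, hs⟩ := Set.mem_iUnion₂.mp hC
    obtain ⟨b', hb', hN⟩ := exists_basis_of_isAlgebraicCF hl hv
    have hbv : v = b' := (funext hb').symm
    have hpos := sail_pos hN (x := t • x) (by rw [← hbv]; exact hs) i
    rw [map_smul, Finsupp.smul_apply, smul_eq_mul] at hpos
    have hscale : ∀ j, ∃ a : ℝ, b' j = a • b j := by
      intro j
      have : b' j ∈ Submodule.span ℝ {b j} := by
        rw [← hb, hv, hb']
        exact Submodule.mem_span_singleton_self _
      obtain ⟨a, ha⟩ := Submodule.mem_span_singleton.mp this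
      exact ⟨a, ha.symm⟩
    choose a ha using hscale
    have h2 : b.repr x i = b'.repr x i * a i := by
      have : x = ∑ j, (b'.repr x j * a j) • b j := by
        conv_lhs => rw [← b'.sum_repr x]
        simp [ha, mul_smul]
      conv_lhs => rw [this]
      rw [b.repr_sum_self]
    have ha0 : a i ≠ 0 := by
      intro h
      have := b'.ne_zero i
      rw [ha, h, zero_smul] at this
      exact this rfl
    rw [h2] at h0
    rcases mul_eq_zero.mp h0 with h | h
    · rw [h] at hpos; simp at hpos
    · exact ha0 h

end

/-! ### Symmetries of the continued fraction as permutations of generators. -/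

section

open Module

/-- The operator of `GL_n(ℤ)` as a linear automorphism of `ℝⁿ`. -/
noncomputable def actEquiv {n : ℕ} (G : GL (Fin n) ℤ) : (Fin n → ℝ) ≃ₗ[ℝ] (Fin n → ℝ) :=
  LinearEquiv.ofLinearMap (act G) (act G⁻¹) (by rw [← act_mul, mul_inv_cancel, act_one])
    (by rw [← act_mul, inv_mul_cancel, act_one])

theorem image_integerPoints {n : ℕ} (G : GL (Fin n) ℤ) :
    act G '' integerPoints n = integerPoints n := by
  have h : ∀ H : GL (Fin n) ℤ, act H '' integerPoints n ⊆ integerPoints n := by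
    rintro H _ ⟨_, ⟨z, rfl⟩, rfl⟩
    exact ⟨_, (act_toReal H z).symm⟩
  refine (h G).antisymm fun x hx => ⟨act G⁻¹ x, h G⁻¹ ⟨x, hx, rfl⟩, act_act_inv G x⟩

theorem image_coneOf {n : ℕ} (f : (Fin n → ℝ) →ₗ[ℝ] (Fin n → ℝ)) (v : Fin n → (Fin n → ℝ)) :
    f '' coneOf v = coneOf fun i => f (v i) := by
  ext x
  constructor
  · rintro ⟨_, ⟨c, hc, rfl⟩, rfl⟩
    exact ⟨c, hc, by simp⟩
  · rintro ⟨c, hc, rfl⟩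
    exact ⟨_, ⟨c, hc, rfl⟩, by simp⟩

theorem coneOf_comp_equiv {n : ℕ} (v : Fin n → (Fin n → ℝ)) (π : Equiv.Perm (Fin n)) :
    coneOf (v ∘ π) = coneOf v := by
  ext x
  constructor
  · rintro ⟨c, hc, rfl⟩
    refine ⟨c ∘ π.symm, fun i => hc _, ?_⟩
    rw [← Equiv.sum_comp π (fun i => (c ∘ π.symm) i • v i)]
    simp
  · rintro ⟨c, hc, rfl⟩
    refine ⟨c ∘ π, fun i => hc _, ?_⟩
    rw [← Equiv.sum_comp π]
    simp

theorem image_sail {n : ℕ} (G : GL (Fin n) ℤ) (C : Set (Fin n → ℝ)) :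
    act G '' sail C = sail (act G '' C) := by
  have hinj : Function.Injective (act G) := (actEquiv G).injective
  have h1 : act G '' kleinPolyhedron C = kleinPolyhedron (act G '' C) := by
    rw [kleinPolyhedron, (act G).isLinear.image_convexHull, Set.image_sdiff hinj,
      Set.image_inter hinj, image_integerPoints, Set.image_singleton, map_zero, kleinPolyhedron]
  rw [sail, sail, ← h1]
  exact (actEquiv G).toContinuousLinearEquiv.toHomeomorph.image_frontier _

theorem image_CF_subset {n : ℕ} {l : Fin n → Submodule ℝ (Fin n → ℝ)} {G : GL (Fin n) ℤ}
    {π : Equiv.Perm (Fin n)} (h : ∀ i, (l i).map (act G) = l (π i)) :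
    act G '' CF l ⊆ CF l := by
  rintro _ ⟨x, hx, rfl⟩
  obtain ⟨C, ⟨v, hv, rfl⟩, hs⟩ := Set.mem_iUnion₂.mp hx
  refine Set.mem_biUnion (x := act G '' coneOf v) ?_ ?_
  · refine mem_cones_iff.mpr ⟨fun i => act G (v (π.symm i)), fun i => ?_, ?_⟩
    · have := h (π.symm i)
      rw [Equiv.apply_symm_apply] at this
      rw [← this, hv, Submodule.map_span, Set.image_singleton]
    · rw [image_coneOf, ← coneOf_comp_equiv _ π.symm]
      rfl
  · rw [← image_sail]
    exact ⟨x, hs, rfl⟩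

theorem isSymmetry_of_permutes {n : ℕ} {l : Fin n → Submodule ℝ (Fin n → ℝ)} {G : GL (Fin n) ℤ}
    {π : Equiv.Perm (Fin n)} (h : ∀ i, (l i).map (act G) = l (π i)) : IsSymmetry l G := by
  refine (image_CF_subset h).antisymm fun x hx => ⟨act G⁻¹ x, ?_, act_act_inv G x⟩
  refine image_CF_subset (π := π.symm) (fun i => ?_) ⟨x, hx, rfl⟩
  have := h (π.symm i)
  rw [Equiv.apply_symm_apply] at this
  rw [← this, ← Submodule.map_comp, ← act_mul, inv_mul_cancel, act_one, Submodule.map_id]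

/-- An operator permuting nontrivially the generators of a cone is a proper palindromic
symmetry. -/
theorem isProperPalindromicSymmetry_of_permutes {n : ℕ} [NeZero n]
    {l : Fin n → Submodule ℝ (Fin n → ℝ)} (hl : IsAlgebraicCF l)
    {v : Fin n → (Fin n → ℝ)} (hv : ∀ i, l i = Submodule.span ℝ {v i})
    {G : GL (Fin n) ℤ} {π : Equiv.Perm (Fin n)} (hπ : π ≠ 1)
    (h : ∀ i, act G (v i) = v (π i)) : IsProperPalindromicSymmetry l G := by
  obtain ⟨b, hb, hN⟩ := exists_basis_of_isAlgebraicCF hl hv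
  obtain rfl : v = b := (funext hb).symm
  have hmap : ∀ i, (l i).map (act G) = l (π i) := fun i => by
    rw [hv, Submodule.map_span, Set.image_singleton, h, hv]
  refine ⟨⟨isSymmetry_of_permutes hmap, fun hD => hπ ?_⟩, ?_⟩
  · ext i
    have h1 := hD.2 i
    rw [hmap, hv, hv] at h1
    have h2 : b (π i) ∈ Submodule.span ℝ {b i} := h1 ▸ Submodule.mem_span_singleton_self _
    obtain ⟨a, ha⟩ := Submodule.mem_span_singleton.mp h2
    by_contra hne
    have := congrArg (fun x => b.repr x (π i)) ha
    have hne' : i ≠ π i := fun h => hne (by rw [← h]; rfl)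
    simp [hne'] at this
  -- The sum of the generators is fixed by every permutation of them, and a positive multiple of it
  -- lies on the sail.
  · obtain ⟨t, ht, hs⟩ := exists_smul_mem_sail hN (x := ∑ i, b i) fun i => by
      have := b.repr_sum_self (fun _ => (1 : ℝ))
      simp only [one_smul] at this
      rw [this]; exact one_pos
    refine ⟨_, mem_cones_iff.mpr ⟨b, hv, rfl⟩, _, hs, ?_⟩
    rw [map_smul, map_sum]
    simp only [h]
    rw [Equiv.sum_comp π]

/-- A functional vanishing only where one of finitely many functionals vanishes is, up to
scaling, one of them. -/
theorem exists_eq_smul_of_vanishing {k E ι : Type*} [Field k] [Infinite k] [AddCommGroup E]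
    [Module k E] [Finite ι] {f : E →ₗ[k] k} {g : ι → E →ₗ[k] k}
    (h : ∀ x, f x = 0 → ∃ i, g i x = 0) : ∃ i, ∃ a : k, g i = a • f := by
  -- A vector space over an infinite field is not a finite union of proper subspaces, so `ker f`
  -- lies in a single `ker (g i)`.
  obtain ⟨i, hi⟩ := Subspace.exists_eq_top_of_iUnion_eq_univ (k := k) (E := LinearMap.ker f)
    (p := fun i => (LinearMap.ker (g i)).comap (LinearMap.ker f).subtype) (by
      refine Set.eq_univ_of_forall fun x => ?_
      obtain ⟨i, hi⟩ := h x x.2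
      exact Set.mem_iUnion.mpr ⟨i, hi⟩)
  refine ⟨i, ?_⟩
  have hker : ⨅ _ : Unit, LinearMap.ker f ≤ LinearMap.ker (g i) := by
    rw [iInf_const]
    intro x hx
    have : (⟨x, hx⟩ : LinearMap.ker f) ∈
        (LinearMap.ker (g i)).comap (LinearMap.ker f).subtype := by rw [hi]; trivial
    exact this
  have := mem_span_of_iInf_ker_le_ker (L := fun _ : Unit => f) hker
  rw [Set.range_const, Submodule.mem_span_singleton] at this
  obtain ⟨a, ha⟩ := this
  exact ⟨a, ha.symm⟩

/-- A symmetry fixing a point of a sail permutes the suitably scaled generators of the cone. -/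
theorem exists_permutes_of_fixed {n : ℕ} [NeZero n]
    {l : Fin n → Submodule ℝ (Fin n → ℝ)} (hl : IsAlgebraicCF l) {G : GL (Fin n) ℤ}
    (hG : IsSymmetry l G) {C : Set (Fin n → ℝ)} (hC : C ∈ cones l) {p : Fin n → ℝ}
    (hp : p ∈ sail C) (hGp : act G p = p) :
    ∃ b : Basis (Fin n) ℝ (Fin n → ℝ), (∀ i, l i = Submodule.span ℝ {b i}) ∧
      ∃ π : Equiv.Perm (Fin n), ∀ i, act G (b i) = b (π i) := by
  obtain ⟨v, hv, rfl⟩ := mem_cones_iff.mp hC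
  obtain ⟨b₀, hb₀, hN⟩ := exists_basis_of_isAlgebraicCF hl hv
  obtain rfl : v = b₀ := (funext hb₀).symm
  have hpos := sail_pos hN hp
  -- The generators are scaled by the coordinates of `p`, all positive on a sail, so that `p`
  -- becomes their sum.
  have hv' : ∀ i, l i = Submodule.span ℝ {b₀.repr p i • b₀ i} := fun i => by
    rw [hv, Submodule.span_singleton_smul_eq (IsUnit.mk0 _ (hpos i).ne')]
  obtain ⟨b, hb, -⟩ := exists_basis_of_isAlgebraicCF hl hv'
  have hbl : ∀ i, l i = Submodule.span ℝ {b i} := fun i => by rw [hb, hv']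
  have hbp : ∀ i, b.repr p i = 1 := by
    intro i
    have : p = ∑ i, (1 : ℝ) • b i := by
      simp only [hb, one_smul]
      exact (b₀.sum_repr p).symm
    rw [this, b.repr_sum_self]
  refine ⟨b, hbl, ?_⟩
  -- The complement of the hyperplanes is described through `CF` alone, so it is invariant under
  -- `G`.
  have hoff : ∀ x, (∀ i, b.repr (act G x) i ≠ 0) ↔ ∀ i, b.repr x i ≠ 0 := by
    intro x
    rw [repr_ne_zero_iff_exists_smul_mem_CF hl hbl, repr_ne_zero_iff_exists_smul_mem_CF hl hbl]
    refine exists_congr fun t => and_congr_right fun _ => ?_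
    rw [← map_smul]
    conv_lhs => rw [← hG]
    exact (actEquiv G).injective.mem_set_image
  have hcoord : ∀ i, ∃ j, b.coord j = b.coord i ∘ₗ act G := by
    intro i
    obtain ⟨j, a, ha⟩ := exists_eq_smul_of_vanishing (f := b.coord i ∘ₗ act G) (g := b.coord)
      fun x hx => by
        by_contra! h
        exact (hoff x).mpr h i hx
    -- All coordinates of the fixed point `p` equal one, which forces the factor `a` to be one.
    have h1 := congrArg (fun f => f p) ha
    simp only [LinearMap.smul_apply, LinearMap.comp_apply, hGp, Basis.coord_apply, hbp,
      smul_eq_mul, mul_one] at h1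
    exact ⟨j, by rw [ha, ← h1, one_smul]⟩
  choose ρ hρ using hcoord
  have hρinj : Function.Injective ρ := by
    intro i j hij
    by_contra hne
    have h1 : b.coord i ∘ₗ act G = b.coord j ∘ₗ act G := by rw [← hρ, ← hρ, hij]
    have h2 := congrArg (fun f => f (act G⁻¹ (b i))) h1
    simp only [LinearMap.comp_apply, act_act_inv, Basis.coord_apply, Basis.repr_self] at h2
    simp [hne] at h2
  let e : Equiv.Perm (Fin n) := Equiv.ofBijective ρ (Finite.injective_iff_bijective.mp hρinj)
  refine ⟨e.symm, fun j => ?_⟩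
  apply b.repr.injective
  ext i
  have h1 := congrArg (fun f => f (b j)) (hρ i)
  simp only [LinearMap.comp_apply, Basis.coord_apply, Basis.repr_self] at h1
  rw [← h1, Basis.repr_self]
  simp only [Finsupp.single_apply]
  congr 1
  rw [Equiv.symm_apply_eq]
  rfl

end

/-! ### The eigenlines as conjugates of a basis of a number field. -/

section

open Module IntermediateField

theorem act_apply {n : ℕ} (A : GL (Fin n) ℤ) (x : Fin n → ℝ) (i : Fin n) :
    act A x i = ∑ j, ((A : Matrix (Fin n) (Fin n) ℤ) i j : ℝ) * x j := by
  simp [act, Matrix.mulVec, dotProduct]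

/-- The embeddings of a simple extension correspond to the real roots of the minimal
polynomial. -/
theorem exists_bijective_embeddings {θ : ℝ} {n : ℕ} (hdeg : (minpoly ℚ θ).natDegree = n)
    (hint : IsIntegral ℚ θ) (hsp : ((minpoly ℚ θ).map (algebraMap ℚ ℝ)).Splits)
    {μ : Fin n → ℝ} (hμ : Function.Injective μ)
    (hroot : ∀ i, Polynomial.aeval (μ i) (minpoly ℚ θ) = 0) :
    ∃ s : Fin n → (ℚ⟮θ⟯ →ₐ[ℚ] ℝ), Function.Bijective s ∧
      ∀ i, s i (AdjoinSimple.gen ℚ θ) = μ i := by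
  have hmem : ∀ i, μ i ∈ (minpoly ℚ θ).aroots ℝ := fun i =>
    Polynomial.mem_aroots.mpr ⟨minpoly.ne_zero hint, hroot i⟩
  let s : Fin n → (ℚ⟮θ⟯ →ₐ[ℚ] ℝ) := fun i => (algHomAdjoinIntegralEquiv ℚ hint).symm ⟨μ i, hmem i⟩
  have hs : ∀ i, s i (AdjoinSimple.gen ℚ θ) = μ i := fun i =>
    algHomAdjoinIntegralEquiv_symm_apply_gen ℚ hint ⟨μ i, hmem i⟩
  have hcard : Nat.card (ℚ⟮θ⟯ →ₐ[ℚ] ℝ) = n :=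
    (card_algHom_adjoin_integral ℚ (K := ℝ) hint (minpoly.irreducible hint).separable hsp).trans
      hdeg
  have : FiniteDimensional ℚ ℚ⟮θ⟯ := adjoin.finiteDimensional hint
  refine ⟨s, (Nat.bijective_iff_injective_and_card s).mpr ⟨fun i j hij => hμ ?_, ?_⟩, hs⟩
  · rw [← hs i, ← hs j, hij]
  · rw [hcard, Nat.card_eq_fintype_card, Fintype.card_fin]

/-- The coordinates of an eigenvector, normalized by its first coordinate, form a basis of
the field that they generate, and the lines are spanned by its conjugates. -/
theorem exists_conjugates {n : ℕ} [NeZero n] {l : Fin n → Submodule ℝ (Fin n → ℝ)}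
    (hl : IsAlgebraicCF l) {w : Fin n → ℝ} (hw0 : w 0 = 1)
    (hw : l 0 = Submodule.span ℝ {w}) {K : IntermediateField ℚ ℝ}
    (hK : K = IntermediateField.adjoin ℚ (Set.range w)) :
    ∃ W : Basis (Fin n) ℚ K, (∀ j, (W j : ℝ) = w j) ∧
      ∃ s : Fin n → (K →ₐ[ℚ] ℝ), Function.Bijective s ∧ s 0 = K.val ∧
        ∀ i, l i = Submodule.span ℝ {fun j => s i (W j)} := by
  obtain ⟨A, hA, μ, hμ, hev⟩ := hl
  set θ := μ 0
  have hdeg := natDegree_minpoly_of_isHyperbolic hA (hev 0).1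
  have hint : IsIntegral ℚ θ := by
    by_contra h
    rw [minpoly.eq_zero h, Polynomial.natDegree_zero] at hdeg
    exact NeZero.ne n hdeg.symm
  have hAw : act A w = θ • w := by
    rw [← Module.End.mem_eigenspace_iff, ← (hev 0).2, hw]
    exact Submodule.mem_span_singleton_self _
  have hw_ne : w ≠ 0 := fun h => by simp [h] at hw0
  -- The matrix `A - θ` is singular already over `ℚ⟮θ⟯`. A kernel vector there spans the same line
  -- as `w`, and dividing by its first coordinate gives `w`.
  have hwF : ∀ j, w j ∈ ℚ⟮θ⟯ := by
    set Mat : Matrix (Fin n) (Fin n) ℚ⟮θ⟯ :=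
      (A : Matrix (Fin n) (Fin n) ℤ).map (Int.castRingHom ℚ⟮θ⟯) -
        Matrix.scalar (Fin n) (AdjoinSimple.gen ℚ θ)
    have hdet : Mat.det = 0 := by
      have hinj : Function.Injective (algebraMap ℚ⟮θ⟯ ℝ) := (algebraMap ℚ⟮θ⟯ ℝ).injective
      apply hinj
      rw [RingHom.map_det, map_zero]
      rw [← Matrix.exists_mulVec_eq_zero_iff]
      refine ⟨w, hw_ne, ?_⟩
      have h1 : (algebraMap ℚ⟮θ⟯ ℝ).mapMatrix Mat =
          (A : Matrix (Fin n) (Fin n) ℤ).map (Int.castRingHom ℝ) - Matrix.scalar (Fin n) θ := by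
        ext i j
        by_cases hij : i = j
        · subst hij; simp [Mat]
        · simp [Mat, hij]
      rw [h1, Matrix.sub_mulVec]
      have h2 : (A : Matrix (Fin n) (Fin n) ℤ).map (Int.castRingHom ℝ) *ᵥ w = θ • w := hAw
      rw [h2]
      ext i
      simp
    obtain ⟨u, hu, hMu⟩ := Matrix.exists_mulVec_eq_zero_iff.mpr hdet
    have hu' : (fun j => (u j : ℝ)) ∈ l 0 := by
      rw [(hev 0).2, Module.End.mem_eigenspace_iff]
      ext i
      have h3 := congrArg (fun x : Fin n → ℚ⟮θ⟯ => ((x i : ℚ⟮θ⟯) : ℝ)) hMu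
      simp only [Mat, Matrix.sub_mulVec, Pi.sub_apply, Pi.zero_apply] at h3
      rw [act_apply]
      simp only [Matrix.mulVec, dotProduct, Matrix.map_apply, Matrix.scalar_apply,
        Matrix.diagonal_apply] at h3
      simp at h3
      simp only [Pi.smul_apply, smul_eq_mul]
      linarith
    rw [hw] at hu'
    obtain ⟨t, ht⟩ := Submodule.mem_span_singleton.mp hu'
    have ht0 : t = (u 0 : ℝ) := by
      have := congrFun ht 0
      simpa [hw0] using this
    have htne : t ≠ 0 := by
      rintro rfl
      apply hu
      funext j
      have := congrFun ht j
      simp only [zero_smul, Pi.zero_apply] at this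
      exact Subtype.ext this.symm
    intro j
    have h4 : w j = (u j : ℝ) / (u 0 : ℝ) := by
      have := congrFun ht j
      simp only [Pi.smul_apply, smul_eq_mul] at this
      rw [← this, ← ht0]
      field_simp
    rw [h4]
    exact div_mem (u j).2 (u 0).2
  have hKθ : K = ℚ⟮θ⟯ := by
    rw [hK]
    apply le_antisymm
    · rw [IntermediateField.adjoin_le_iff]
      rintro _ ⟨j, rfl⟩
      exact hwF j
    · rw [IntermediateField.adjoin_simple_le_iff]
      have h5 : θ = ∑ j, ((A : Matrix (Fin n) (Fin n) ℤ) 0 j : ℝ) * w j := by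
        have := congrFun hAw 0
        rw [act_apply] at this
        simp only [Pi.smul_apply, smul_eq_mul, hw0, mul_one] at this
        exact this.symm
      rw [h5]
      exact sum_mem fun j _ => mul_mem (intCast_mem _ _)
        (IntermediateField.subset_adjoin _ _ ⟨j, rfl⟩)
  clear hK
  subst hKθ
  let W : Fin n → ℚ⟮θ⟯ := fun j => ⟨w j, hwF j⟩
  have hAW : ∀ i, ∑ j, ((A : Matrix (Fin n) (Fin n) ℤ) i j : ℚ⟮θ⟯) * W j =
      AdjoinSimple.gen ℚ θ * W i := by
    intro i
    apply Subtype.ext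
    have := congrFun hAw i
    rw [act_apply] at this
    simpa [W] using this
  have hfin : FiniteDimensional ℚ ℚ⟮θ⟯ := adjoin.finiteDimensional hint
  have hrank : finrank ℚ ℚ⟮θ⟯ = n := by rw [adjoin.finrank hint, hdeg]
  -- The span is stable under multiplication by `θ` and contains `W 0 = 1`, hence all powers of `θ`.
  have hspan : ⊤ ≤ Submodule.span ℚ (Set.range W) := by
    have hmul : ∀ x ∈ Submodule.span ℚ (Set.range W),
        AdjoinSimple.gen ℚ θ * x ∈ Submodule.span ℚ (Set.range W) := by
      intro x hx
      induction hx using Submodule.span_induction with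
      | mem x hx =>
        obtain ⟨i, rfl⟩ := hx
        rw [← hAW]
        refine Submodule.sum_mem _ fun j _ => ?_
        have : ((A : Matrix (Fin n) (Fin n) ℤ) i j : ℚ⟮θ⟯) * W j =
            ((A : Matrix (Fin n) (Fin n) ℤ) i j : ℚ) • W j := by
          rw [Algebra.smul_def]; simp
        rw [this]
        exact Submodule.smul_mem _ _ (Submodule.subset_span ⟨j, rfl⟩)
      | zero => simp
      | add x y _ _ hx hy => rw [mul_add]; exact Submodule.add_mem _ hx hy
      | smul a x _ hx => rw [mul_smul_comm]; exact Submodule.smul_mem _ _ hx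
    have hpow : ∀ k : ℕ, AdjoinSimple.gen ℚ θ ^ k ∈ Submodule.span ℚ (Set.range W) := by
      intro k
      induction k with
      | zero =>
        have : (1 : ℚ⟮θ⟯) = W 0 := Subtype.ext hw0.symm
        rw [pow_zero, this]
        exact Submodule.subset_span ⟨0, rfl⟩
      | succ k ih => rw [pow_succ']; exact hmul _ ih
    rw [← (adjoin.powerBasis hint).basis.span_eq, Submodule.span_le]
    rintro _ ⟨k, rfl⟩
    rw [PowerBasis.coe_basis, adjoin.powerBasis_gen]
    exact hpow _
  have hW : LinearIndependent ℚ W := linearIndependent_of_top_le_span_of_card_eq_finrank hspan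
    (by rw [hrank, Fintype.card_fin])
  have hmin := minpoly_of_isHyperbolic hA (hev 0).1
  obtain ⟨s, hs, hsgen⟩ := exists_bijective_embeddings hdeg hint
    (by
      have h1 : ((A : Matrix (Fin n) (Fin n) ℤ).map (Int.castRingHom ℚ)).map (algebraMap ℚ ℝ) =
          (A : Matrix (Fin n) (Fin n) ℤ).map (Int.castRingHom ℝ) := by
        ext i j
        simp
      rw [hmin, ← Matrix.charpoly_map, h1]
      exact hA.2)
    hμ (fun i => by rw [hmin]; exact aeval_eq_zero_of_hasEigenvalue (hev i).1)
  refine ⟨Basis.mk hW hspan, fun j => by simp [W], s, hs, ?_, fun i => ?_⟩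
  · refine IntermediateField.algHom_ext_of_eq_adjoin ℚ (S := ℚ⟮θ⟯) rfl ?_
    rintro x hx
    obtain rfl : x = θ := hx
    exact hsgen 0
  -- Conjugating the equation `A W = θ W` by `s i` gives an eigenvector for `μ i`.
  · have hsw : ∀ i, act A (fun j => s i (W j)) = μ i • fun j => s i (W j) := by
      intro i
      ext k
      rw [act_apply]
      have := congrArg (s i) (hAW k)
      rw [map_sum, map_mul, hsgen] at this
      simpa using this
    have hsne : ∀ i, (fun j => s i (W j)) ≠ 0 := by
      intro i h
      have h0 := congrFun h 0
      have : W 0 = 1 := Subtype.ext hw0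
      simp [this] at h0
    have hli : LinearIndependent ℝ fun i j => s i (W j) :=
      Module.End.eigenvectors_linearIndependent' (act A) μ hμ _
        fun i => ⟨Module.End.mem_eigenspace_iff.mpr (hsw i), hsne i⟩
    let b := basisOfLinearIndependentOfCardEqFinrank hli (by simp)
    have hb : ∀ i, b i = fun j => s i (W j) := fun i => by simp [b]
    simp only [Basis.mk_apply]
    rw [(hev i).2]
    apply le_antisymm
    · intro x hx
      rw [Module.End.mem_eigenspace_iff] at hx
      have hc : ∀ k, k ≠ i → b.repr x k = 0 := by
        intro k hk
        have h1 : act A x = ∑ j, (b.repr x j * μ j) • b j := by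
          conv_lhs => rw [← b.sum_repr x]
          rw [map_sum]
          refine Finset.sum_congr rfl fun j _ => ?_
          rw [map_smul, hb, hsw, smul_smul]
        have h2 := congrArg (fun y => b.repr y k) (h1.symm.trans hx)
        simp only [b.repr_sum_self, map_smul, Finsupp.smul_apply, smul_eq_mul] at h2
        have h3 : b.repr x k * (μ k - μ i) = 0 := by linarith
        rcases mul_eq_zero.mp h3 with h | h
        · exact h
        · exact absurd (hμ (sub_eq_zero.mp h)) hk
      rw [Submodule.mem_span_singleton]
      refine ⟨b.repr x i, ?_⟩
      conv_rhs => rw [← b.sum_repr x]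
      rw [Finset.sum_eq_single i, hb]
      · intro k _ hk
        rw [hc k hk, zero_smul]
      · simp
    · rw [Submodule.span_singleton_le_iff_mem, Module.End.mem_eigenspace_iff]
      exact hsw i

end

/-! ### Integer involutions of trace zero in rank four. -/

section

open Module

/-- An involution of trace zero on a free module of rank four, in a basis adapted to its fixed
submodule. -/
theorem exists_basis_involution {Λ : Type*} [AddCommGroup Λ] [Module.Free ℤ Λ]
    [Module.Finite ℤ Λ] (hΛ : finrank ℤ Λ = 4) {φ : Λ →ₗ[ℤ] Λ} (hφ : φ ∘ₗ φ = LinearMap.id)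
    (htr : LinearMap.trace ℤ Λ φ = 0) :
    ∃ (B : Basis (Fin 2 ⊕ Fin 2) ℤ Λ) (S : Matrix (Fin 2) (Fin 2) ℤ),
      (∀ i, φ (B (Sum.inl i)) = B (Sum.inl i)) ∧
      ∀ j, φ (B (Sum.inr j)) = -B (Sum.inr j) + ∑ i, S j i • B (Sum.inl i) := by
  set W := LinearMap.ker (φ - LinearMap.id)
  have hW : ∀ x, x ∈ W ↔ φ x = x := fun x => by
    simp [W, sub_eq_zero]
  -- The quotient embeds in `Λ` as the range of `φ - id`, so a basis of `W` extends to one of `Λ`.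
  have : Module.Free ℤ (Λ ⧸ W) :=
    Module.Free.of_equiv (LinearMap.quotKerEquivRange (φ - LinearMap.id)).symm
  let bW := Module.finBasis ℤ W
  let bQ := Module.finBasis ℤ (Λ ⧸ W)
  -- `φ` is the identity on `W` and minus the identity on the quotient, because `φ x + x` is always
  -- fixed. So `m - k` is the trace `0`, while `m + k = 4`.
  have key : ∀ (m k : ℕ) (bW : Basis (Fin m) ℤ W) (bQ : Basis (Fin k) ℤ (Λ ⧸ W)),
      m = 2 ∧ k = 2 := by
    intro m k bW bQ
    let B := Basis.sumQuot bW bQ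
    have hcard : m + k = 4 := by
      have := Module.finrank_eq_card_basis B
      rw [hΛ] at this
      simpa using this.symm
    rw [LinearMap.trace_eq_matrix_trace ℤ B, Matrix.trace, Fintype.sum_sum_type] at htr
    have h1 : ∀ i, (LinearMap.toMatrix B B φ).diag (Sum.inl i) = 1 := by
      intro i
      rw [Matrix.diag_apply, LinearMap.toMatrix_apply]
      have : φ (B (Sum.inl i)) = B (Sum.inl i) :=
        (hW _).mp (by rw [Basis.sumQuot_inl]; exact (bW i).2)
      rw [this]
      simp
    have h2 : ∀ j, (LinearMap.toMatrix B B φ).diag (Sum.inr j) = -1 := by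
      intro j
      rw [Matrix.diag_apply, LinearMap.toMatrix_apply]
      have hmem : φ (B (Sum.inr j)) + B (Sum.inr j) ∈ W := by
        rw [hW, map_add, ← LinearMap.comp_apply, hφ, LinearMap.id_apply, add_comm]
      have h3 := Basis.sumQuot_repr_inr_of_mem bW bQ _ hmem j
      rw [map_add, Finsupp.add_apply] at h3
      have h4 : (Basis.sumQuot bW bQ).repr (B (Sum.inr j)) (Sum.inr j) = 1 := by
        change B.repr (B (Sum.inr j)) (Sum.inr j) = 1
        simp
      rw [h4] at h3
      change (Basis.sumQuot bW bQ).repr (φ (B (Sum.inr j))) (Sum.inr j) = -1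
      linarith
    simp only [h1, h2] at htr
    simp at htr
    omega
  obtain ⟨hm, hk⟩ := key _ _ bW bQ
  let bW' := bW.reindex (finCongr hm)
  let bQ' := bQ.reindex (finCongr hk)
  let B := Basis.sumQuot bW' bQ'
  have hmem : ∀ j, φ (B (Sum.inr j)) + B (Sum.inr j) ∈ W := fun j => by
    rw [hW, map_add, ← LinearMap.comp_apply, hφ, LinearMap.id_apply, add_comm]
  refine ⟨B, fun j i => bW'.repr ⟨_, hmem j⟩ i, fun i => ?_, fun j => ?_⟩
  · exact (hW _).mp (by rw [Basis.sumQuot_inl]; exact (bW' i).2)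
  · have h5 := congrArg (W.subtype) (bW'.sum_repr ⟨_, hmem j⟩)
    rw [map_sum] at h5
    simp only [map_smul, Submodule.subtype_apply] at h5
    have h6 : ∀ i, B (Sum.inl i) = bW' i := fun i => Basis.sumQuot_inl bW' bQ' i
    simp only [h6]
    rw [h5]
    abel

/-- The Smith form of a two-by-two integer matrix modulo two. -/
theorem exists_smith_mod_two (S : Matrix (Fin 2) (Fin 2) ℤ) :
    ∃ P Q Y D : Matrix (Fin 2) (Fin 2) ℤ, IsUnit P.det ∧ IsUnit Q.det ∧
      Y + Q * S = D * P - Y ∧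
      (D = !![0, 0; 0, 0] ∨ D = !![1, 0; 0, 0] ∨ D = !![1, 0; 0, 1]) := by
  -- An adapted change of basis with blocks `P`, `0`, `Y`, `Q` replaces `S` by `(Q * S + 2 * Y) *
  -- P⁻¹`. Thus only `S` modulo two matters, which leaves sixteen matrices with entries `0` and `1`.
  obtain ⟨S₀, S₁, hS, h01⟩ : ∃ S₀ S₁ : Matrix (Fin 2) (Fin 2) ℤ, S = S₀ + (2 : ℤ) • S₁ ∧
      ∀ i j, S₀ i j = 0 ∨ S₀ i j = 1 := by
    refine ⟨Matrix.of fun i j => S i j % 2, Matrix.of fun i j => S i j / 2, ?_, fun i j => ?_⟩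
    · ext i j
      simp only [Matrix.add_apply, Matrix.smul_apply, Matrix.of_apply, smul_eq_mul]
      omega
    · exact Int.emod_two_eq_zero_or_one _
  suffices h : ∃ P Q D : Matrix (Fin 2) (Fin 2) ℤ, IsUnit P.det ∧ IsUnit Q.det ∧
      Q * S₀ = D * P ∧
      (D = !![0, 0; 0, 0] ∨ D = !![1, 0; 0, 0] ∨ D = !![1, 0; 0, 1]) by
    obtain ⟨P, Q, D, hP, hQ, hQS, hD⟩ := h
    refine ⟨P, Q, -(Q * S₁), D, hP, hQ, ?_, hD⟩
    rw [hS, mul_add, hQS, mul_smul_comm, two_smul]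
    abel
  have hdet : ∀ a b c d : ℤ, (a * d - b * c = 1 ∨ a * d - b * c = -1) →
      IsUnit (!![a, b; c, d]).det := fun a b c d h => by
    rw [Matrix.det_fin_two_of]
    rcases h with h | h <;> rw [h] <;> simp
  have key : ∀ a b c d p q r s p' q' r' s' e f : ℤ,
      (p * s - q * r = 1 ∨ p * s - q * r = -1) → (p' * s' - q' * r' = 1 ∨ p' * s' - q' * r' = -1) →
      ((e = 0 ∧ f = 0) ∨ (e = 1 ∧ f = 0) ∨ (e = 1 ∧ f = 1)) →
      (p' * a + q' * c = e * p ∧ p' * b + q' * d = e * q ∧ r' * a + s' * c = f * r ∧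
        r' * b + s' * d = f * s) →
      ∃ P Q D : Matrix (Fin 2) (Fin 2) ℤ, IsUnit P.det ∧ IsUnit Q.det ∧
      Q * !![a, b; c, d] = D * P ∧
      (D = !![0, 0; 0, 0] ∨ D = !![1, 0; 0, 0] ∨ D = !![1, 0; 0, 1]) := by
    intro a b c d p q r s p' q' r' s' e f h1 h2 h3 ⟨h4, h5, h6, h7⟩
    refine ⟨!![p, q; r, s], !![p', q'; r', s'], !![e, 0; 0, f], hdet _ _ _ _ h1, hdet _ _ _ _ h2,
      ?_, ?_⟩
    · simp only [Matrix.mul_fin_two, h4, h5, h6, h7]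
      simp
    · rcases h3 with ⟨rfl, rfl⟩ | ⟨rfl, rfl⟩ | ⟨rfl, rfl⟩ <;> simp
  rw [Matrix.eta_fin_two S₀]
  rcases h01 0 0 with h00 | h00 <;> rcases h01 0 1 with h1 | h1 <;>
    rcases h01 1 0 with h2 | h2 <;> rcases h01 1 1 with h3 | h3 <;> rw [h00, h1, h2, h3]
  · exact key _ _ _ _ 1 0 0 1 1 0 0 1 0 0 (by simp) (by simp) (by simp) (by simp)
  · exact key _ _ _ _ 0 1 1 0 0 1 1 0 1 0 (by simp) (by simp) (by simp) (by simp)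
  · exact key _ _ _ _ 1 0 0 1 0 1 1 0 1 0 (by simp) (by simp) (by simp) (by simp)
  · exact key _ _ _ _ 1 1 0 1 0 1 1 0 1 0 (by simp) (by simp) (by simp) (by simp)
  · exact key _ _ _ _ 0 1 1 0 1 0 0 1 1 0 (by simp) (by simp) (by simp) (by simp)
  · exact key _ _ _ _ 0 1 1 0 1 0 (-1) 1 1 0 (by simp) (by simp) (by simp) (by simp)
  · exact key _ _ _ _ 0 1 1 0 1 0 0 1 1 1 (by simp) (by simp) (by simp) (by simp)
  · exact key _ _ _ _ 0 1 1 1 1 0 0 1 1 1 (by simp) (by simp) (by simp) (by simp)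
  · exact key _ _ _ _ 1 0 0 1 1 0 0 1 1 0 (by simp) (by simp) (by simp) (by simp)
  · exact key _ _ _ _ 1 0 0 1 1 0 0 1 1 1 (by simp) (by simp) (by simp) (by simp)
  · exact key _ _ _ _ 1 0 0 1 1 0 (-1) 1 1 0 (by simp) (by simp) (by simp) (by simp)
  · exact key _ _ _ _ 1 0 1 1 1 0 0 1 1 1 (by simp) (by simp) (by simp) (by simp)
  · exact key _ _ _ _ 1 1 0 1 1 0 0 1 1 0 (by simp) (by simp) (by simp) (by simp)
  · exact key _ _ _ _ 1 1 0 1 1 0 0 1 1 1 (by simp) (by simp) (by simp) (by simp)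
  · exact key _ _ _ _ 1 1 1 0 1 0 0 1 1 1 (by simp) (by simp) (by simp) (by simp)
  · exact key _ _ _ _ 1 1 0 1 1 0 (-1) 1 1 0 (by simp) (by simp) (by simp) (by simp)

/-- The matrix of an involution with `(1, ω, ψ, χ) ↦ (1, χ, t - ω - ψ - χ, ω)`. -/
def swapInvolution (t : ℤ) : Matrix (Fin 4) (Fin 4) ℤ :=
  !![1, 0, 0, 0; 0, 0, 0, 1; t, -1, -1, -1; 0, 1, 0, 0]

/-- The matrix of the involution with `(1, ω, ψ, χ) ↦ (1, 2χ - ω, -2χ - ψ, χ)`. -/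
def halfInvolution : Matrix (Fin 4) (Fin 4) ℤ :=
  !![1, 0, 0, 0; 0, -1, 0, 2; 0, 0, -1, -2; 0, 0, 0, 1]

/-- The matrix, in a basis adapted to the fixed submodule, of an involution. -/
def adaptedInvolution (S : Matrix (Fin 2) (Fin 2) ℤ) :
    Matrix (Fin 2 ⊕ Fin 2) (Fin 2 ⊕ Fin 2) ℤ :=
  Matrix.fromBlocks 1 0 S (-1)

/-- Integer involutions of trace zero in dimension four are conjugate to one of three. -/
theorem exists_conjugate_involution {M : Matrix (Fin 4) (Fin 4) ℤ} (hM : M * M = 1)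
    (htr : M.trace = 0) :
    ∃ (B : GL (Fin 4) ℤ) (T : Matrix (Fin 4) (Fin 4) ℤ),
      (B : Matrix (Fin 4) (Fin 4) ℤ) * M = T * B ∧
      (T = swapInvolution 0 ∨ T = swapInvolution 1 ∨ T = halfInvolution) := by
  -- The transpose makes `φ` act on row vectors, so that the new basis vectors are the rows of the
  -- conjugating matrix.
  let φ := Matrix.toLin' Mᵀ
  have hφa : ∀ x, φ x = x ᵥ* M := fun x => by
    rw [Matrix.toLin'_apply, Matrix.mulVec_transpose]
  have hφ : φ ∘ₗ φ = LinearMap.id := by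
    rw [← Matrix.toLin'_mul, ← Matrix.transpose_mul, hM, Matrix.transpose_one, Matrix.toLin'_one]
  have hφtr : LinearMap.trace ℤ (Fin 4 → ℤ) φ = 0 := by
    rw [LinearMap.trace_eq_matrix_trace ℤ (Pi.basisFun ℤ (Fin 4)), LinearMap.toMatrix_eq_toMatrix',
      LinearMap.toMatrix'_toLin', Matrix.trace_transpose, htr]
  obtain ⟨b, S, hb1, hb2⟩ := exists_basis_involution (by simp) hφ hφtr
  obtain ⟨P, Q, Y, D, hP, hQ, hY, hD⟩ := exists_smith_mod_two S
  set Bm : Matrix (Fin 2 ⊕ Fin 2) (Fin 4) ℤ := Matrix.of fun i j => b i j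
  set U : Matrix (Fin 2 ⊕ Fin 2) (Fin 2 ⊕ Fin 2) ℤ := Matrix.fromBlocks P 0 Y Q
  have hBM : Bm * M = adaptedInvolution S * Bm := by
    ext i j
    have h1 : (Bm * M) i j = φ (b i) j := by rw [hφa]; rfl
    rw [h1]
    rcases i with i | i
    · rw [hb1, Matrix.mul_apply, Fintype.sum_sum_type]
      simp [adaptedInvolution, Bm, Matrix.one_apply]
    · rw [hb2, Matrix.mul_apply, Fintype.sum_sum_type]
      simp [adaptedInvolution, Bm, Matrix.one_apply]
      ring
  have hU : U * adaptedInvolution S = adaptedInvolution D * U := by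
    simp only [adaptedInvolution, U, Matrix.fromBlocks_multiply]
    congr 1 <;> simp [hY, sub_eq_add_neg]
  have hUdet : IsUnit U.det := by
    rw [Matrix.det_fromBlocks_zero₁₂]
    exact hP.mul hQ
  have hBinv : Bm * (b.toMatrix (Pi.basisFun ℤ (Fin 4)))ᵀ = 1 := by
    have h1 : Bm = ((Pi.basisFun ℤ (Fin 4)).toMatrix b)ᵀ := by
      ext i j
      simp [Bm, Basis.toMatrix_apply]
    rw [h1, ← Matrix.transpose_mul, Basis.toMatrix_mul_toMatrix_flip, Matrix.transpose_one]
  have hmain : ∀ (C : Matrix (Fin 4) (Fin 2 ⊕ Fin 2) ℤ) (C' : Matrix (Fin 2 ⊕ Fin 2) (Fin 4) ℤ)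
      (T : Matrix (Fin 4) (Fin 4) ℤ), C * C' = 1 →
      C * adaptedInvolution D = T * C →
      ∃ B : GL (Fin 4) ℤ, (B : Matrix (Fin 4) (Fin 4) ℤ) * M = T * B := by
    intro C C' T hC hT
    have hinv : (C * U * Bm) * ((b.toMatrix (Pi.basisFun ℤ (Fin 4)))ᵀ * U⁻¹ * C') = 1 := by
      calc _ = C * (U * (Bm * (b.toMatrix (Pi.basisFun ℤ (Fin 4)))ᵀ) * U⁻¹) * C' := by
            simp only [Matrix.mul_assoc]
        _ = 1 := by
          rw [hBinv, Matrix.mul_one, Matrix.mul_nonsing_inv _ hUdet, Matrix.mul_one, hC]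
    refine ⟨⟨C * U * Bm, _, hinv, mul_eq_one_comm.mp hinv⟩, ?_⟩
    calc C * U * Bm * M = C * (U * (Bm * M)) := by simp only [Matrix.mul_assoc]
      _ = C * ((U * adaptedInvolution S) * Bm) := by rw [hBM, Matrix.mul_assoc]
      _ = (C * adaptedInvolution D) * U * Bm := by rw [hU]; simp only [Matrix.mul_assoc]
      _ = T * (C * U * Bm) := by rw [hT]; simp only [Matrix.mul_assoc]
  let e : Fin 2 ⊕ Fin 2 ≃ Fin 4 := finSumFinEquiv
  have hred : ∀ (C C' N T : Matrix (Fin 4) (Fin 4) ℤ), C * C' = 1 → C * N = T * C →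
      N.submatrix e e = adaptedInvolution D →
      ∃ B : GL (Fin 4) ℤ, (B : Matrix (Fin 4) (Fin 4) ℤ) * M = T * B := by
    intro C C' N T h1 h2 h3
    refine hmain (C.submatrix id e) (C'.submatrix e id) T ?_ ?_
    · rw [Matrix.submatrix_mul_equiv, h1]; simp
    · rw [← h3, Matrix.submatrix_mul_equiv, h2]
      rfl
  -- The rows of the first matrix are the coordinates of the future `1, ω, ψ, χ` in the adapted
  -- basis; the first row is a fixed basis vector. The second matrix is the inverse.
  rcases hD with rfl | rfl | rfl
  · obtain ⟨B, hB⟩ := hred !![0, 1, 0, 0; 1, 0, 1, 0; -1, 0, -1, 1; 1, 0, 0, 0]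
      !![0, 0, 0, 1; 1, 0, 0, 0; 0, 1, 0, -1; 0, 1, 1, 0]
      !![1, 0, 0, 0; 0, 1, 0, 0; 0, 0, -1, 0; 0, 0, 0, -1] halfInvolution
      (by decide) (by decide) (by
        ext (i | i) (j | j) <;> fin_cases i <;> fin_cases j <;> rfl)
    exact ⟨B, _, hB, by simp⟩
  · obtain ⟨B, hB⟩ := hred !![0, 1, 0, 0; 0, 0, 1, 0; 0, 0, -1, 1; 1, 0, -1, 0]
      !![0, 1, 0, 1; 1, 0, 0, 0; 0, 1, 0, 0; 0, 1, 1, 0]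
      !![1, 0, 0, 0; 0, 1, 0, 0; 1, 0, -1, 0; 0, 0, 0, -1] (swapInvolution 0)
      (by decide) (by decide) (by
        ext (i | i) (j | j) <;> fin_cases i <;> fin_cases j <;> rfl)
    exact ⟨B, _, hB, by simp⟩
  · obtain ⟨B, hB⟩ := hred !![0, 1, 0, 0; 0, 0, 1, 0; 0, 0, -1, 1; 1, 0, -1, 0]
      !![0, 1, 0, 1; 1, 0, 0, 0; 0, 1, 0, 0; 0, 1, 1, 0]
      !![1, 0, 0, 0; 0, 1, 0, 0; 1, 0, -1, 0; 0, 1, 0, -1] (swapInvolution 1)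
      (by decide) (by decide) (by
        ext (i | i) (j | j) <;> fin_cases i <;> fin_cases j <;> rfl)
    exact ⟨B, _, hB, by simp⟩

end

/-! ### Integer matrices over fields, and the field endomorphism induced by a permutation of lines.
-/

section

open Module IntermediateField

/-- The action of an integer matrix on vectors over any commutative ring. -/
def intAct {n : ℕ} {R : Type*} [CommRing R] (N : Matrix (Fin n) (Fin n) ℤ) (u : Fin n → R) :
    Fin n → R :=
  N.map (Int.castRingHom R) *ᵥ u

section intAct

variable {n : ℕ} {R S : Type*} [CommRing R] [CommRing S]

theorem intAct_apply (N : Matrix (Fin n) (Fin n) ℤ) (u : Fin n → R) (i : Fin n) :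
    intAct N u i = ∑ j, (N i j : R) * u j := rfl

theorem intAct_mul (M N : Matrix (Fin n) (Fin n) ℤ) (u : Fin n → R) :
    intAct (M * N) u = intAct M (intAct N u) := by
  simp only [intAct, Matrix.map_mul, Matrix.mulVec_mulVec]

theorem intAct_one (u : Fin n → R) : intAct 1 u = u := by
  simp [intAct]

theorem intAct_sub (M N : Matrix (Fin n) (Fin n) ℤ) (u : Fin n → R) :
    intAct (M - N) u = intAct M u - intAct N u := by
  ext i
  simp [intAct_apply, sub_mul]

theorem intAct_smul (N : Matrix (Fin n) (Fin n) ℤ) (a : R) (u : Fin n → R) :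
    intAct N (a • u) = a • intAct N u := by
  simp only [intAct, Matrix.mulVec_smul]

theorem map_intAct (f : R →+* S) (N : Matrix (Fin n) (Fin n) ℤ) (u : Fin n → R) :
    (fun i => f (intAct N u i)) = intAct N fun i => f (u i) := by
  ext i
  simp [intAct_apply]

theorem map_intAct_apply (f : R →+* S) (N : Matrix (Fin n) (Fin n) ℤ) (u : Fin n → R) (i : Fin n) :
    f (intAct N u i) = intAct N (fun i => f (u i)) i := congrFun (map_intAct f N u) i

theorem intAct_inv_intAct (G : GL (Fin n) ℤ) (u : Fin n → R) :
    intAct (G⁻¹ : GL (Fin n) ℤ) (intAct G u) = u := by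
  rw [← intAct_mul, ← Units.val_mul, inv_mul_cancel, Units.val_one, intAct_one]

end intAct

theorem eq_zero_of_intAct_eq_zero {n : ℕ} {K : Type*} [Field K] [Algebra ℚ K] {u : Fin n → K}
    (hu : LinearIndependent ℚ u) {N : Matrix (Fin n) (Fin n) ℤ} (h : intAct N u = 0) : N = 0 := by
  ext i j
  have h1 : ∑ j, (N i j : ℚ) • u j = 0 := by
    have := congrFun h i
    rw [intAct_apply] at this
    rw [← Pi.zero_apply (M := fun _ => K) i, ← this]
    refine Finset.sum_congr rfl fun j _ => ?_
    rw [Algebra.smul_def]; simp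
  have := Fintype.linearIndependent_iff.mp hu _ h1 j
  exact_mod_cast this

/-- Since `G⁻¹` is an integer matrix, the new family spans everything that `u` spans, with equally
many vectors. -/
theorem linearIndependent_intAct {n : ℕ} {K : Type*} [Field K] [Algebra ℚ K] {u : Fin n → K}
    (hu : LinearIndependent ℚ u) (G : GL (Fin n) ℤ) :
    LinearIndependent ℚ (intAct (G : Matrix (Fin n) (Fin n) ℤ) u) := by
  have : Nonempty (Fin n) ∨ IsEmpty (Fin n) := (isEmpty_or_nonempty _).symm
  rcases this with _ | _
  swap
  · exact linearIndependent_empty_type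
  have hsub : Submodule.span ℚ (Set.range u) ≤
      Submodule.span ℚ (Set.range (intAct (G : Matrix (Fin n) (Fin n) ℤ) u)) := by
    rw [Submodule.span_le]
    rintro _ ⟨i, rfl⟩
    have h1 := congrFun (intAct_inv_intAct G u) i
    rw [intAct_apply] at h1
    rw [← h1]
    refine Submodule.sum_mem _ fun j _ => ?_
    rw [← Rat.cast_intCast (α := K) ((G⁻¹ : GL (Fin n) ℤ) i j), ← eq_ratCast (algebraMap ℚ K),
      ← Algebra.smul_def]
    exact Submodule.smul_mem _ _ (Submodule.subset_span ⟨j, rfl⟩)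
  rw [linearIndependent_iff_card_le_finrank_span]
  have h2 := linearIndependent_iff_card_le_finrank_span.mp hu
  have : FiniteDimensional ℚ
      (Submodule.span ℚ (Set.range (intAct (G : Matrix (Fin n) (Fin n) ℤ) u))) :=
    FiniteDimensional.span_of_finite ℚ (Set.finite_range _)
  exact h2.trans (Submodule.finrank_mono hsub)

/-- Among the translates of an element of a quartic field by multiples of another one, all but
finitely many are generators. -/
theorem finite_natDegree_minpoly_ne {K : Type*} [Field K] [Algebra ℚ K] [FiniteDimensional ℚ K]
    (hK : finrank ℚ K = 4) {x y : K} (hxy : LinearIndependent ℚ ![1, x, y]) :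
    {k : ℤ | (minpoly ℚ (x + k * y)).natDegree ≠ 4}.Finite := by
  have : Finite (IntermediateField ℚ K) :=
    (Field.exists_primitive_element_iff_finite_intermediateField ℚ K).mp
      ⟨inferInstance, Field.exists_primitive_element ℚ K⟩
  -- There are finitely many intermediate fields, and distinct exceptional `k` give distinct ones: a
  -- field `L` occurring twice would contain `1, x, y`, so its degree would be at least three and
  -- divide four.
  refine Set.Finite.of_injOn (f := fun k : ℤ => ℚ⟮x + k * y⟯) (t := Set.univ)
    (fun _ _ => Set.mem_univ _) ?_ Set.finite_univ
  intro k₁ h₁ k₂ h₂ heq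
  by_contra hne
  simp only at heq
  set L := ℚ⟮x + k₁ * y⟯
  have hL : finrank ℚ L ≠ 4 := by
    rw [adjoin.finrank (Algebra.IsIntegral.isIntegral _)]
    exact h₁
  have hm₁ : x + k₁ * y ∈ L := mem_adjoin_simple_self ℚ _
  have hm₂ : x + k₂ * y ∈ L := heq ▸ mem_adjoin_simple_self ℚ _
  have hy : y ∈ L := by
    have h3 : ((k₁ - k₂ : ℤ) : K) * y ∈ L := by
      convert sub_mem hm₁ hm₂ using 1
      push_cast; ring
    have h4 : ((k₁ - k₂ : ℤ) : K) ≠ 0 := by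
      have : CharZero K := algebraRat.charZero K
      exact_mod_cast sub_ne_zero.mpr hne
    have h5 := mul_mem (inv_mem (intCast_mem L (k₁ - k₂))) h3
    rwa [inv_mul_cancel_left₀ h4] at h5
  have hx : x ∈ L := by
    have := sub_mem hm₁ (mul_mem (intCast_mem L k₁) hy)
    rwa [add_sub_cancel_right] at this
  have hsub : Submodule.span ℚ (Set.range ![1, x, y]) ≤ Subalgebra.toSubmodule L.toSubalgebra := by
    rw [Submodule.span_le]
    rintro _ ⟨i, rfl⟩
    fin_cases i
    · exact one_mem L
    · exact hx
    · exact hy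
  have h3 : 3 ≤ finrank ℚ L := by
    have h6 := finrank_span_eq_card hxy
    rw [Fintype.card_fin] at h6
    exact h6.ge.trans (Submodule.finrank_mono hsub)
  have hdvd : finrank ℚ L ∣ 4 := by
    rw [← hK, ← finrank_mul_finrank ℚ L K]
    exact dvd_mul_right _ _
  have hle := Nat.le_of_dvd (by norm_num) hdvd
  interval_cases h : finrank ℚ L
  · omega
  · exact hL rfl

/-- An operator permuting generators of the lines acts on the first line through an
endomorphism of the field. -/
theorem exists_algHom_of_permutes {n : ℕ} [NeZero n] {l : Fin n → Submodule ℝ (Fin n → ℝ)}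
    {K : IntermediateField ℚ ℝ} {W : Basis (Fin n) ℚ K} (hW0 : W 0 = 1)
    {s : Fin n → (K →ₐ[ℚ] ℝ)} (hs0 : s 0 = K.val)
    (hl : ∀ i, l i = Submodule.span ℝ {fun j => s i (W j)})
    {b : Basis (Fin n) ℝ (Fin n → ℝ)} (hb : ∀ i, l i = Submodule.span ℝ {b i})
    {G : GL (Fin n) ℤ} {π : Equiv.Perm (Fin n)} (hG : ∀ i, act G (b i) = b (π i)) :
    ∃ (τ : K →ₐ[ℚ] K) (c : K), c ≠ 0 ∧ (∀ i, s (π i) = (s i).comp τ) ∧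
      ∀ i, intAct G W i = c * τ (W i) := by
  have hmap : ∀ i, ∃ c : ℝ, act G (fun j => s i (W j)) = c • fun j => s (π i) (W j) := by
    intro i
    have h1 : act G (fun j => s i (W j)) ∈ (l i).map (act G) :=
      Submodule.mem_map_of_mem (by rw [hl]; exact Submodule.mem_span_singleton_self _)
    rw [hb, Submodule.map_span, Set.image_singleton, hG, ← hb, hl] at h1
    obtain ⟨c, hc⟩ := Submodule.mem_span_singleton.mp h1
    exact ⟨c, hc.symm⟩
  have hact : ∀ i, act G (fun j => s i (W j)) = fun j => s i (intAct G W j) := fun i =>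
    (map_intAct (s i : K →+* ℝ) (G : Matrix (Fin n) (Fin n) ℤ) W).symm
  have hfirst : ∀ i, ∀ c : ℝ, act G (fun j => s i (W j)) = c • (fun j => s (π i) (W j)) →
      c = s i (intAct G W 0) := by
    intro i c hc
    have := congrFun hc 0
    rw [hact] at this
    simpa [hW0] using this.symm
  set c : K := intAct G W 0
  have hc : c ≠ 0 := by
    intro h0
    obtain ⟨a, ha⟩ := hmap 0
    have h1 := hfirst 0 a ha
    rw [h0, map_zero] at h1
    rw [h1, zero_smul] at ha
    have h2 := (actEquiv G).injective (ha.trans (map_zero (actEquiv G)).symm)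
    have h3 := congrFun h2 0
    simp [hW0] at h3
  -- The factor between the `i`-th conjugate's image and the target line's generator is read off at
  -- coordinate `0`, where `W 0 = 1`; it is the conjugate `s i c`.
  have hval : ∀ i j, s i (intAct G W j) = s i c * s (π i) (W j) := by
    intro i j
    obtain ⟨a, ha⟩ := hmap i
    rw [hfirst i a ha, hact] at ha
    exact congrFun ha j
  -- For `i = 0` the previous identity writes `s (π 0) (W j)` as a quotient of elements of `K`.
  have hmem : ∀ x, s (π 0) x ∈ K := by
    intro x
    rw [← W.sum_repr x, map_sum]
    refine sum_mem fun j _ => ?_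
    rw [map_rat_smul, Algebra.smul_def]
    refine mul_mem (K.algebraMap_mem _) ?_
    have h1 := hval 0 j
    rw [hs0] at h1
    have h2 : s (π 0) (W j) = (intAct G W j / c : K) := by
      have hc' : (c : ℝ) ≠ 0 := fun h => hc (Subtype.ext h)
      rw [IntermediateField.coe_div, eq_div_iff hc', mul_comm]
      exact h1.symm
    rw [h2]
    exact SetLike.coe_mem _
  let τ : K →ₐ[ℚ] K := AlgHom.codRestrict (s (π 0)) K.toSubalgebra hmem
  have hτ : ∀ x, ((τ x : K) : ℝ) = s (π 0) x := fun x => rfl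
  have hact' : ∀ i, intAct G W i = c * τ (W i) := by
    intro i
    apply Subtype.ext
    have h1 := hval 0 i
    rw [hs0] at h1
    exact h1
  refine ⟨τ, c, hc, fun i => ?_, hact'⟩
  apply AlgHom.toLinearMap_injective
  refine W.ext fun j => ?_
  have h1 := hval i j
  rw [hact', map_mul] at h1
  have hc' : s i c ≠ 0 := (map_ne_zero (s i)).mpr hc
  exact (mul_left_cancel₀ hc' h1).symm

end

/-! ### From a palindromic symmetry to the relations. -/

section

open Module IntermediateField

-- The hypotheses leave only the four-cycles.
set_option maxRecDepth 100000 in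
theorem perm_four_pow_eq_one (π : Equiv.Perm (Fin 4)) (h1 : ∀ i, π i ≠ i)
    (h2 : ∀ i, π (π i) ≠ i) : (π * π) * (π * π) = 1 := by
  revert π
  decide

-- Relabels the embeddings so that the two orbits of the involution become `{0, 2}` and `{1, 3}`, as
-- `EmbeddingConditions` requires.
set_option maxRecDepth 100000 in
theorem exists_perm_of_involution (π : Equiv.Perm (Fin 4)) (h1 : ∀ i, π i ≠ i)
    (h2 : π * π = 1) : ∃ ρ : Equiv.Perm (Fin 4), ρ 0 = 0 ∧ ρ 2 = π 0 ∧ ρ 3 = π (ρ 1) := by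
  revert π
  decide

theorem trace_eq_zero_of_permutes {n : ℕ} {b : Basis (Fin n) ℝ (Fin n → ℝ)} {G : GL (Fin n) ℤ}
    {π : Equiv.Perm (Fin n)} (hG : ∀ i, act G (b i) = b (π i)) (hπ : ∀ i, π i ≠ i) :
    (G : Matrix (Fin n) (Fin n) ℤ).trace = 0 := by
  have h1 : LinearMap.trace ℝ _ (act G) = 0 := by
    rw [LinearMap.trace_eq_matrix_trace ℝ b, Matrix.trace]
    refine Finset.sum_eq_zero fun i _ => ?_
    rw [Matrix.diag_apply, LinearMap.toMatrix_apply, hG]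
    simp [hπ i]
  rw [act, LinearMap.trace_eq_matrix_trace ℝ (Pi.basisFun ℝ (Fin n)),
    LinearMap.toMatrix_eq_toMatrix', LinearMap.toMatrix'_toLin'] at h1
  have h2 : (((G : Matrix (Fin n) (Fin n) ℤ).trace : ℤ) : ℝ) = 0 := by
    rw [← h1]
    simp [Matrix.trace]
  exact_mod_cast h2

/-- The determinant one matrix adding to the second and subtracting from the third coordinate
`k` times their sum, with `p` times it subtracted from, and `q` added to, the last one. -/
def shear (k p q : ℤ) : GL (Fin 4) ℤ where
  val := !![1, 0, 0, 0; 0, 1 + k, k, 0; 0, -k, 1 - k, 0; q, -p, -p, 1]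
  inv := !![1, 0, 0, 0; 0, 1 - k, -k, 0; 0, k, 1 + k, 0; -q, p, p, 1]
  val_inv := by
    ext i j
    fin_cases i <;> fin_cases j <;> simp [Matrix.mul_apply, Fin.sum_univ_four] <;> ring
  inv_val := by
    ext i j
    fin_cases i <;> fin_cases j <;> simp [Matrix.mul_apply, Fin.sum_univ_four] <;> ring

theorem act_shear (k p q : ℤ) (x y z : ℝ) :
    act (shear k p q) ![1, x, y, z] =
      ![1, x + k * (x + y), y - k * (x + y), z - p * (x + y) + q] := by
  ext i
  rw [act_apply, Fin.sum_univ_four]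
  fin_cases i <;> simp [shear] <;> ring

theorem Equivalent.shear {v : Fin 4 → ℝ} {x y z : ℝ} (h : Equivalent v ![1, x, y, z])
    (k p q : ℤ) :
    Equivalent v ![1, x + k * (x + y), y - k * (x + y), z - p * (x + y) + q] := by
  obtain ⟨X, μ, hμ, hX⟩ := h
  refine ⟨KleinCF.shear k p q * X, μ, hμ, ?_⟩
  rw [act_mul, LinearMap.comp_apply, hX, map_smul, act_shear]

/-- Integer changes of coordinates make the second and the third coordinate generate the field. -/
theorem exists_shear_natDegree {K : Type*} [Field K] [Algebra ℚ K] [FiniteDimensional ℚ K]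
    (hK : finrank ℚ K = 4) {y : Fin 4 → K} (hy : LinearIndependent ℚ y) (hy0 : y 0 = 1) :
    ∃ k : ℤ, (minpoly ℚ (y 1 + k * (y 1 + y 2))).natDegree = 4 ∧
      (minpoly ℚ (y 2 - k * (y 1 + y 2))).natDegree = 4 := by
  have hcoef := Fintype.linearIndependent_iff.mp hy
  have h1 : LinearIndependent ℚ ![1, y 1, y 1 + y 2] := by
    rw [Fintype.linearIndependent_iff]
    intro g hg
    have h2 := hcoef ![g 0, g 1 + g 2, g 2, 0] (by
      simp only [Fin.sum_univ_three, Fin.sum_univ_four] at hg ⊢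
      simp only [Matrix.cons_val, Matrix.cons_val_zero, Matrix.cons_val_one] at hg ⊢
      simp only [Algebra.smul_def, map_add, map_zero] at hg ⊢
      rw [hy0]
      linear_combination hg)
    have e0 := h2 0
    have e1 := h2 1
    have e2 := h2 2
    simp at e0 e1 e2
    intro i
    fin_cases i
    · exact e0
    · change g 1 = 0
      linarith
    · exact e2
  have h1' : LinearIndependent ℚ ![1, y 2, -(y 1 + y 2)] := by
    rw [Fintype.linearIndependent_iff]
    intro g hg
    have h2 := hcoef ![g 0, -g 2, g 1 - g 2, 0] (by
      simp only [Fin.sum_univ_three, Fin.sum_univ_four] at hg ⊢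
      simp only [Matrix.cons_val, Matrix.cons_val_zero, Matrix.cons_val_one] at hg ⊢
      simp only [Algebra.smul_def, map_sub, map_neg, map_zero] at hg ⊢
      rw [hy0]
      linear_combination hg)
    have e0 := h2 0
    have e1 := h2 1
    have e2 := h2 2
    simp at e0 e1 e2
    intro i
    fin_cases i
    · exact e0
    · change g 1 = 0
      linarith
    · exact e1
  -- Each of the two degree conditions excludes finitely many integers.
  obtain ⟨k, hk⟩ := ((finite_natDegree_minpoly_ne hK h1).union
    (finite_natDegree_minpoly_ne hK h1')).infinite_compl.nonempty
  simp only [Set.mem_compl_iff, Set.mem_union, Set.mem_ofPred_eq, not_or, not_not] at hk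
  refine ⟨k, hk.1, ?_⟩
  rw [sub_eq_add_neg, ← mul_neg]
  exact hk.2

/-- A nontrivial permutation of the generators of a cone may be replaced by a fixed point free
involution. -/
theorem exists_involution_of_permutes {l : Fin 4 → Submodule ℝ (Fin 4 → ℝ)}
    {K : IntermediateField ℚ ℝ} {W : Basis (Fin 4) ℚ K} (hW0 : W 0 = 1)
    {s : Fin 4 → (K →ₐ[ℚ] ℝ)} (hs : Function.Bijective s) (hs0 : s 0 = K.val)
    (hl : ∀ i, l i = Submodule.span ℝ {fun j => s i (W j)})
    {b : Basis (Fin 4) ℝ (Fin 4 → ℝ)} (hb : ∀ i, l i = Submodule.span ℝ {b i})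
    {G : GL (Fin 4) ℤ} {π : Equiv.Perm (Fin 4)} (hG : ∀ i, act G (b i) = b (π i))
    (hπ : π ≠ 1) :
    ∃ (H : GL (Fin 4) ℤ) (ρ : Equiv.Perm (Fin 4)), (∀ i, act H (b i) = b (ρ i)) ∧
      (∀ i, ρ i ≠ i) ∧ ρ * ρ = 1 := by
  -- A fixed index `i` gives `s i ∘ τ = s i`, hence `τ = id`, and then every index is fixed.
  have hfree : ∀ (H : GL (Fin 4) ℤ) (ρ : Equiv.Perm (Fin 4)), (∀ i, act H (b i) = b (ρ i)) →
      ρ ≠ 1 → ∀ i, ρ i ≠ i := by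
    intro H ρ hH hρ i hi
    obtain ⟨τ, c, -, hτ, -⟩ := exists_algHom_of_permutes hW0 hs0 hl hb hH
    have h1 : ∀ x, τ x = x := by
      intro x
      apply (s i : K →+* ℝ).injective
      have := hτ i
      rw [hi] at this
      exact (congrArg (fun f => f x) this).symm
    apply hρ
    ext j
    have h2 : s (ρ j) = s j := by
      rw [hτ j]
      ext x
      simp [h1]
    rw [hs.1 h2]
    rfl
  by_cases h : π * π = 1
  · exact ⟨G, π, hG, hfree G π hG hπ, h⟩
  · have hGG : ∀ i, act (G * G) (b i) = b ((π * π) i) := fun i => by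
      rw [act_mul, LinearMap.comp_apply, hG, hG]
      rfl
    have h2 := hfree _ _ hGG h
    exact ⟨G * G, π * π, hGG, h2, perm_four_pow_eq_one π (hfree G π hG hπ) h2⟩

/-- The three conjugacy classes of involutions yield relations (1), (2) and (4) respectively; no
other relation is needed in this direction. -/
theorem exists_tenRelations {l : Fin 4 → Submodule ℝ (Fin 4 → ℝ)}
    {K : IntermediateField ℚ ℝ} {W : Basis (Fin 4) ℚ K} (hW0 : W 0 = 1)
    {s : Fin 4 → (K →ₐ[ℚ] ℝ)} (hs : Function.Bijective s) (hs0 : s 0 = K.val)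
    (hl : ∀ i, l i = Submodule.span ℝ {fun j => s i (W j)})
    {b : Basis (Fin 4) ℝ (Fin 4 → ℝ)} (hb : ∀ i, l i = Submodule.span ℝ {b i})
    {G : GL (Fin 4) ℤ} {π : Equiv.Perm (Fin 4)} (hG : ∀ i, act G (b i) = b (π i))
    (hπ : π ≠ 1) :
    ∃ σ : Fin 4 → (K →ₐ[ℚ] ℝ), Function.Bijective σ ∧ σ 0 = K.val ∧
      EmbeddingConditions K (σ 1) (σ 2) (σ 3) ∧
      ∃ ω ψ : K, (minpoly ℚ ω).natDegree = 4 ∧ (minpoly ℚ ψ).natDegree = 4 ∧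
        TenRelations (fun j => (W j : ℝ)) ω ψ (σ 2 ω) (σ 2 ψ) := by
  obtain ⟨H, ρ, hH, hfree, hρ⟩ := exists_involution_of_permutes hW0 hs hs0 hl hb hG hπ
  obtain ⟨τ, c, hc, hτ, hHW⟩ := exists_algHom_of_permutes hW0 hs0 hl hb hH
  have hρρ : ∀ i, ρ (ρ i) = i := fun i => by
    rw [← Equiv.Perm.mul_apply, hρ, Equiv.Perm.one_apply]
  have hττ : ∀ x, τ (τ x) = x := by
    intro x
    apply (s 0 : K →+* ℝ).injective
    have h1 := hτ (ρ 0)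
    rw [hρρ, hτ 0] at h1
    exact (congrArg (fun f => f x) h1).symm
  have hττ' : τ.comp τ = AlgHom.id ℚ K := AlgHom.ext hττ
  obtain ⟨κ, hκ0, hκ2, hκ3⟩ := exists_perm_of_involution ρ hfree hρ
  have hσ2 : ∀ x, (s ∘ κ) 2 x = ((τ x : K) : ℝ) := fun x => by
    simp only [Function.comp_apply, hκ2, hτ 0, hs0]
    rfl
  refine ⟨s ∘ κ, hs.comp κ.bijective, by rw [Function.comp_apply, hκ0, hs0], ⟨?_, ?_, τ, ?_, hττ', ?_⟩, ?_⟩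
  · ext x
    rw [AlgHom.mem_fieldRange]
    constructor
    · rintro ⟨y, rfl⟩
      rw [hσ2]
      exact SetLike.coe_mem _
    · exact fun hx => ⟨τ ⟨x, hx⟩, by rw [hσ2, hττ]⟩
  · simp only [Function.comp_apply, hκ3, hτ (κ 1)]
    ext x
    simp only [AlgHom.mem_fieldRange, AlgHom.comp_apply]
    exact ⟨fun ⟨y, hy⟩ => ⟨τ y, hy⟩, fun ⟨y, hy⟩ => ⟨τ y, by rw [hττ, hy]⟩⟩
  · exact AlgHom.ext fun x => (hσ2 x).symm
  · simp only [Function.comp_apply, hκ3, hτ (κ 1)]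
  -- an integer basis in which the involution has a standard form
  have hHH : H * H = 1 := by
    apply eq_of_act_eq
    refine b.ext fun i => ?_
    rw [act_mul, act_one, LinearMap.comp_apply, hH, hH, hρρ, LinearMap.id_apply]
  obtain ⟨B, T, hBT, hT⟩ := exists_conjugate_involution
    (M := (H : Matrix (Fin 4) (Fin 4) ℤ)) (by rw [← Units.val_mul, hHH, Units.val_one])
    (trace_eq_zero_of_permutes hH hfree)
  have hu := linearIndependent_intAct W.linearIndependent B
  set u : Fin 4 → K := intAct (B : Matrix (Fin 4) (Fin 4) ℤ) W
  have hTu : ∀ i, intAct T u i = c * τ (u i) := by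
    have h1 : intAct (H : Matrix (Fin 4) (Fin 4) ℤ) W = c • fun i => τ (W i) := funext hHW
    intro i
    have h2 : intAct T u = c • fun i => τ (u i) := by
      rw [← intAct_mul, ← hBT, intAct_mul, h1, intAct_smul]
      congr 1
      exact (map_intAct (τ : K →+* K) (B : Matrix (Fin 4) (Fin 4) ℤ) W).symm
    exact congrFun h2 i
  have hu0 : u 0 ≠ 0 := hu.ne_zero 0
  -- The first row of each standard matrix is that of the identity. Hence dividing `u` by `u 0`
  -- removes the factor `c`, and `T` acts on the quotient `y` exactly as `τ`.
  have hu0τ : u 0 = c * τ (u 0) := by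
    rw [← hTu 0]
    rcases hT with rfl | rfl | rfl <;>
      simp [intAct_apply, Fin.sum_univ_four, swapInvolution, halfInvolution]
  set y : Fin 4 → K := (u 0)⁻¹ • u
  have hy0 : y 0 = 1 := inv_mul_cancel₀ hu0
  have hy : LinearIndependent ℚ y := by
    rw [Fintype.linearIndependent_iff]
    intro g hg
    refine Fintype.linearIndependent_iff.mp hu g ?_
    have h1 : (u 0)⁻¹ * ∑ i, g i • u i = 0 := by
      rw [← hg, Finset.mul_sum]
      refine Finset.sum_congr rfl fun i _ => ?_
      rw [mul_smul_comm]
      rfl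
    exact (mul_eq_zero.mp h1).resolve_left (inv_ne_zero hu0)
  have hTy : ∀ i, τ (y i) = intAct T y i := by
    intro i
    have hcτ : c * τ (u 0) ≠ 0 := hu0τ ▸ hu0
    have h1 : intAct T y i = (u 0)⁻¹ * intAct T u i := congrFun (intAct_smul T _ u) i
    rw [h1, hTu, hu0τ]
    simp only [y, Pi.smul_apply, smul_eq_mul, map_mul, map_inv₀]
    have : τ (u 0) ≠ 0 := right_ne_zero_of_mul hcτ
    field_simp
  have hequiv : Equivalent (fun j => (W j : ℝ)) ![1, (y 1 : ℝ), (y 2 : ℝ), (y 3 : ℝ)] := by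
    refine ⟨B, (u 0 : ℝ), fun h => hu0 (Subtype.ext h), ?_⟩
    have h1 : act B (fun j => (W j : ℝ)) = fun i => ((u i : K) : ℝ) :=
      (map_intAct (algebraMap K ℝ) (B : Matrix (Fin 4) (Fin 4) ℤ) W).symm
    have h2 : ∀ i, u i = u 0 * y i := fun i => by
      simp only [y, Pi.smul_apply, smul_eq_mul, mul_inv_cancel_left₀ hu0]
    rw [h1]
    ext i
    have h3 : (u i : ℝ) = (u 0 : ℝ) * (y i : ℝ) := by
      rw [← IntermediateField.coe_mul, ← h2]
    have h4 : ((y 0 : K) : ℝ) = 1 := by rw [hy0]; rfl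
    rw [h3]
    fin_cases i <;> simp [h4]
  have hfin : FiniteDimensional ℚ K := Module.Finite.of_basis W
  have hrank : finrank ℚ K = 4 := by rw [Module.finrank_eq_card_basis W, Fintype.card_fin]
  obtain ⟨k, hk1, hk2⟩ := exists_shear_natDegree hrank hy hy0
  refine ⟨y 1 + k * (y 1 + y 2), y 2 - k * (y 1 + y 2), hk1, hk2, ?_⟩
  simp only [hσ2]
  have h1 := hTy 1
  have h2 := hTy 2
  rw [intAct_apply, Fin.sum_univ_four] at h1 h2
  -- The shear keeps `ω + ψ = y 1 + y 2`, and its last two parameters keep the form of the fourth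
  -- coordinate. For `swapInvolution t`, `τ` sends `y 1 + y 2` to `t - y 3` plus `y 3 - (y 1 + y
  -- 2)`, so `τ ω` is `y 3 - k * (y 1 + y 2) + k * t`. For `halfInvolution`, `y 1 + y 2` changes
  -- sign, so `(ω + τ ω) / 2` stays `y 3`.
  rcases hT with rfl | rfl | rfl <;> simp [swapInvolution, halfInvolution, hy0] at h1 h2
  · left
    constructor
    · convert hequiv.shear k k 0 using 1
      ext i
      fin_cases i <;> simp [h1, h2] <;> ring
    · simp [h1, h2]
      ring
  · right; left
    constructor
    · convert hequiv.shear k k k using 1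
      ext i
      fin_cases i <;> simp [h1, h2] <;> ring
    · simp [h1, h2]
      ring
  · right; right; right; left
    constructor
    · convert hequiv.shear k 0 0 using 1
      ext i
      have hcast : ((2 : K) : ℝ) = 2 := rfl
      fin_cases i <;> simp [h1, h2, hcast] <;> ring
    · simp [h1, h2]
      ring

end

/-! ### From the relations to a palindromic symmetry. -/

section

open Module IntermediateField

/-- Each of the ten relations makes the lattice spanned by the coordinates invariant under the
involution. -/
theorem exists_integer_matrix_of_tenRelations {K : IntermediateField ℚ ℝ} {v : Fin 4 → ℝ}
    {τ : K →ₐ[ℚ] K} (hτ : ∀ x, τ (τ x) = x) {ω ψ : K}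
    (h : TenRelations v ω ψ (τ ω : K) (τ ψ : K)) :
    ∃ (u : Fin 4 → K) (M : Matrix (Fin 4) (Fin 4) ℤ), u 0 = 1 ∧
      Equivalent v (fun i => (u i : ℝ)) ∧ ∀ i, intAct M u i = τ (u i) := by
  -- With `χ` the fourth number, the twelve integers are the coordinates of `τ ω`, `τ ψ`, `τ χ` in
  -- `1, ω, ψ, χ`; each relation is solved for them below.
  have key : ∀ (χ : K) (z : ℝ) (a₀ a₁ a₂ a₃ b₀ b₁ b₂ b₃ c₀ c₁ c₂ c₃ : ℤ),
      Equivalent v ![1, (ω : ℝ), (ψ : ℝ), z] → z = (χ : ℝ) →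
      τ ω = a₀ + a₁ * ω + a₂ * ψ + a₃ * χ →
      τ ψ = b₀ + b₁ * ω + b₂ * ψ + b₃ * χ →
      τ χ = c₀ + c₁ * ω + c₂ * ψ + c₃ * χ →
      ∃ (u : Fin 4 → K) (M : Matrix (Fin 4) (Fin 4) ℤ), u 0 = 1 ∧
        Equivalent v (fun i => (u i : ℝ)) ∧ ∀ i, intAct M u i = τ (u i) := by
    intro χ z a₀ a₁ a₂ a₃ b₀ b₁ b₂ b₃ c₀ c₁ c₂ c₃ hv hz h1 h2 h3
    refine ⟨![1, ω, ψ, χ], !![1, 0, 0, 0; a₀, a₁, a₂, a₃; b₀, b₁, b₂, b₃; c₀, c₁, c₂, c₃], rfl,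
      ?_, ?_⟩
    · convert hv using 1
      ext i
      fin_cases i <;> simp [hz]
    · intro i
      rw [intAct_apply, Fin.sum_univ_four]
      fin_cases i <;> simp [h1, h2, h3]
  have hτ2 : τ (2 : K) = 2 := map_ofNat τ 2
  have hτ4 : τ (4 : K) = 4 := map_ofNat τ 4
  have down : ∀ x y : K, (x : ℝ) = y → x = y := fun x y hxy => Subtype.ext hxy
  rcases h with ⟨hv, h⟩ | ⟨hv, h⟩ | ⟨hv, h⟩ | ⟨hv, h⟩ | ⟨hv, h⟩ | ⟨hv, h⟩ | ⟨hv, h⟩ | ⟨hv, h⟩ |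
    ⟨hv, h⟩ | ⟨hv, h⟩
  · have h' : ψ + τ ψ = -(ω + τ ω) := down _ _ (by push_cast; exact h)
    exact key (τ ω) _ 0 0 0 1 0 (-1) (-1) (-1) 0 1 0 0 hv rfl (by push_cast; ring)
      (by push_cast; linear_combination h') (by rw [hτ]; push_cast; ring)
  · have h' : ψ + τ ψ = 1 - (ω + τ ω) := down _ _ (by push_cast; exact h)
    exact key (τ ω) _ 0 0 0 1 1 (-1) (-1) (-1) 0 1 0 0 hv rfl (by push_cast; ring)
      (by push_cast; linear_combination h') (by rw [hτ]; push_cast; ring)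
  · have h' : ψ + τ ψ = 2 - (ω + τ ω) := down _ _ (by push_cast; exact h)
    exact key (τ ω) _ 0 0 0 1 2 (-1) (-1) (-1) 0 1 0 0 hv rfl (by push_cast; ring)
      (by push_cast; linear_combination h') (by rw [hτ]; push_cast; ring)
  · have h' : ψ + τ ψ = -(ω + τ ω) := down _ _ (by push_cast; exact h)
    exact key ((ω + τ ω) / 2) _ 0 (-1) 0 2 0 0 (-1) (-2) 0 0 0 1 hv (by push_cast; rfl)
      (by push_cast; ring) (by push_cast; linear_combination h')
      (by simp only [map_div₀, map_add, hτ, hτ2]; push_cast; ring)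
  · have h' : ψ + τ ψ = 2 - (ω + τ ω) := down _ _ (by push_cast; exact h)
    exact key ((ω + τ ω) / 2) _ 0 (-1) 0 2 2 0 (-1) (-2) 0 0 0 1 hv (by push_cast; rfl)
      (by push_cast; ring) (by push_cast; linear_combination h')
      (by simp only [map_div₀, map_add, hτ, hτ2]; push_cast; ring)
  · have h' : ψ + τ ψ = -(ω + τ ω) := down _ _ (by push_cast; exact h)
    exact key ((ω + τ ω + 1) / 2) _ (-1) (-1) 0 2 1 0 (-1) (-2) 0 0 0 1 hv (by push_cast; rfl)
      (by push_cast; ring) (by push_cast; linear_combination h')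
      (by simp only [map_div₀, map_add, map_one, hτ, hτ2]; push_cast; ring)
  · have h' : ψ + τ ψ = 2 - (ω + τ ω) := down _ _ (by push_cast; exact h)
    exact key ((ω + τ ω + 1) / 2) _ (-1) (-1) 0 2 3 0 (-1) (-2) 0 0 0 1 hv (by push_cast; rfl)
      (by push_cast; ring) (by push_cast; linear_combination h')
      (by simp only [map_div₀, map_add, map_one, hτ, hτ2]; push_cast; ring)
  · have h' : ψ + τ ψ = 1 - (ω + τ ω) / 2 := down _ _ (by push_cast; exact h)
    exact key ((ω + τ ω) / 2) _ 0 (-1) 0 2 1 0 (-1) (-1) 0 0 0 1 hv (by push_cast; rfl)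
      (by push_cast; ring) (by push_cast; linear_combination h')
      (by simp only [map_div₀, map_add, hτ, hτ2]; push_cast; ring)
  · have h' : ψ + τ ψ = 2 - (ω + τ ω) / 2 := down _ _ (by push_cast; exact h)
    exact key ((ω + τ ω) / 2) _ 0 (-1) 0 2 2 0 (-1) (-1) 0 0 0 1 hv (by push_cast; rfl)
      (by push_cast; ring) (by push_cast; linear_combination h')
      (by simp only [map_div₀, map_add, hτ, hτ2]; push_cast; ring)
  · have h' : ψ + τ ψ = 2 - (ω + τ ω) / 2 := down _ _ (by push_cast; exact h)
    exact key ((τ ω - ω) / 4) _ 0 1 0 4 2 (-1) (-1) (-2) 0 0 0 (-1) hv (by push_cast; rfl)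
      (by push_cast; ring) (by push_cast; linear_combination h')
      (by simp only [map_div₀, map_sub, hτ, hτ4]; push_cast; ring)

/-- An involution of the field preserving a lattice similar to that of the coordinates gives a
proper palindromic symmetry. -/
theorem exists_symmetry_of_invariant_lattice {n : ℕ} [NeZero n]
    {l : Fin n → Submodule ℝ (Fin n → ℝ)} (hCF : IsAlgebraicCF l)
    {K : IntermediateField ℚ ℝ} {W : Basis (Fin n) ℚ K}
    {s : Fin n → (K →ₐ[ℚ] ℝ)} (hs : Function.Bijective s)
    (hl : ∀ i, l i = Submodule.span ℝ {fun j => s i (W j)})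
    {τ : K →ₐ[ℚ] K} (hτ : ∀ x, τ (τ x) = x) (hτ1 : ∃ x, τ x ≠ x) {u : Fin n → K}
    {M : Matrix (Fin n) (Fin n) ℤ} (hu0 : u 0 = 1)
    (hequiv : Equivalent (fun j => (W j : ℝ)) fun i => (u i : ℝ))
    (hM : ∀ i, intAct M u i = τ (u i)) :
    ∃ G : GL (Fin n) ℤ, IsProperPalindromicSymmetry l G := by
  obtain ⟨X, μ, hμ, hX⟩ := hequiv
  have hX' : ∀ i, ((intAct (X : Matrix (Fin n) (Fin n) ℤ) W i : K) : ℝ) = μ * (u i : ℝ) := by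
    intro i
    have h1 := map_intAct_apply (algebraMap K ℝ) (X : Matrix (Fin n) (Fin n) ℤ) W i
    exact h1.trans (congrFun hX i)
  set ν : K := intAct (X : Matrix (Fin n) (Fin n) ℤ) W 0
  have hν : (ν : ℝ) = μ := by rw [hX', hu0]; simp
  have hν0 : ν ≠ 0 := by
    intro h
    rw [h] at hν
    exact hμ hν.symm
  have hXW : intAct (X : Matrix (Fin n) (Fin n) ℤ) W = ν • u := by
    ext i
    rw [hX', ← hν]
    rfl
  -- This scaling of `W` is mapped by `X` exactly onto `u`, so conjugating `M` by `X` gives an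
  -- operator acting on `V` as `τ`.
  set V : Fin n → K := ν⁻¹ • (W : Fin n → K)
  have hXV : intAct (X : Matrix (Fin n) (Fin n) ℤ) V = u := by
    rw [intAct_smul, hXW, smul_smul, inv_mul_cancel₀ hν0, one_smul]
  have hV : LinearIndependent ℚ V := by
    rw [Fintype.linearIndependent_iff]
    intro g hg
    refine Fintype.linearIndependent_iff.mp W.linearIndependent g ?_
    have h1 : ν⁻¹ * ∑ i, g i • W i = 0 := by
      rw [← hg, Finset.mul_sum]
      refine Finset.sum_congr rfl fun i _ => ?_
      rw [mul_smul_comm]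
      rfl
    exact (mul_eq_zero.mp h1).resolve_left (inv_ne_zero hν0)
  have hu : LinearIndependent ℚ u := hXV ▸ linearIndependent_intAct hV X
  have hMu : intAct M u = fun i => τ (u i) := funext hM
  -- Two applications of `M` act on `u` as `τ ∘ τ = id`, and an integer matrix is determined by its
  -- action on a rationally independent family.
  have hMM : M * M = 1 := by
    rw [← sub_eq_zero]
    refine eq_zero_of_intAct_eq_zero hu ?_
    have h1 : intAct M (fun i => τ (u i)) = u := by
      have h2 := map_intAct (τ : K →+* K) M u
      refine h2.symm.trans (funext fun i => ?_)
      rw [hM]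
      exact hτ _
    rw [intAct_sub, intAct_one, intAct_mul, hMu, h1, sub_self]
  let M' : GL (Fin n) ℤ := ⟨M, M, hMM, hMM⟩
  let G : GL (Fin n) ℤ := X⁻¹ * M' * X
  have hGV : intAct (G : Matrix (Fin n) (Fin n) ℤ) V = fun i => τ (V i) := by
    have h1 : intAct (X : Matrix (Fin n) (Fin n) ℤ) (fun i => τ (V i)) = fun i => τ (u i) := by
      have h2 := map_intAct (τ : K →+* K) (X : Matrix (Fin n) (Fin n) ℤ) V
      rw [hXV] at h2
      exact h2.symm
    calc intAct (G : Matrix (Fin n) (Fin n) ℤ) V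
        = intAct (X⁻¹ : GL (Fin n) ℤ) (intAct M (intAct X V)) := by
          rw [← intAct_mul, ← intAct_mul]
          rfl
      _ = fun i => τ (V i) := by rw [hXV, hMu, ← h1, intAct_inv_intAct]
  let e : Fin n ≃ (K →ₐ[ℚ] ℝ) := Equiv.ofBijective s hs
  -- Composition with `τ` permutes the embeddings, and `G` permutes the conjugates of `V` in the
  -- same way.
  let p : Fin n → Fin n := fun i => e.symm ((s i).comp τ)
  have hp : ∀ i, s (p i) = (s i).comp τ := fun i => e.apply_symm_apply _
  have hpp : Function.Involutive p := by
    intro i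
    apply hs.1
    rw [hp, hp]
    ext x
    simp [hτ]
  have hπ : hpp.toPerm p ≠ 1 := by
    intro h
    obtain ⟨x, hx⟩ := hτ1
    apply hx
    apply (s 0 : K →+* ℝ).injective
    have h1 : p 0 = 0 := congrArg (fun f : Equiv.Perm (Fin n) => f 0) h
    have h2 := hp 0
    rw [h1] at h2
    exact (congrArg (fun f => f x) h2).symm
  refine ⟨G, isProperPalindromicSymmetry_of_permutes hCF (v := fun i j => s i (V j)) ?_ hπ ?_⟩
  · intro i
    have h1 : (fun j => s i (V j)) = s i ν⁻¹ • fun j => s i (W j) := by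
      ext j
      simp [V]
    have h2 : s i ν⁻¹ ≠ 0 := (map_ne_zero (s i)).mpr (inv_ne_zero hν0)
    rw [h1, Submodule.span_singleton_smul_eq (IsUnit.mk0 _ h2), hl]
  · intro i
    have h1 := map_intAct (s i : K →+* ℝ) (G : Matrix (Fin n) (Fin n) ℤ) V
    refine h1.symm.trans (funext fun j => ?_)
    rw [hGV]
    exact (congrArg (fun f => f (V j)) (hp i)).symm

end

end KleinCF

/-! ### The criterion. -/

theorem theorem1 (l : Fin 4 → Submodule ℝ (Fin 4 → ℝ)) (hl : KleinCF.IsAlgebraicCF l)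
    (α β γ : ℝ) (hl₁ : l 0 = Submodule.span ℝ {![1, α, β, γ]})
    (K : IntermediateField ℚ ℝ) (hK : K = IntermediateField.adjoin ℚ {α, β, γ}) :
    (∃ G : Matrix.GeneralLinearGroup (Fin 4) ℤ, KleinCF.IsProperPalindromicSymmetry l G) ↔
      ∃ σ : Fin 4 → (K →ₐ[ℚ] ℝ), Function.Bijective σ ∧ σ 0 = K.val ∧
        KleinCF.EmbeddingConditions K (σ 1) (σ 2) (σ 3) ∧
        ∃ ω ψ : K, (minpoly ℚ ω).natDegree = 4 ∧ (minpoly ℚ ψ).natDegree = 4 ∧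
          KleinCF.TenRelations ![1, α, β, γ] ω ψ (σ 2 ω) (σ 2 ψ) := by
  have hK' : K = IntermediateField.adjoin ℚ (Set.range ![1, α, β, γ]) := by
    rw [hK]
    apply le_antisymm
    · refine IntermediateField.adjoin.mono _ _ _ ?_
      rintro x (rfl | rfl | rfl)
      exacts [⟨1, rfl⟩, ⟨2, rfl⟩, ⟨3, rfl⟩]
    · rw [IntermediateField.adjoin_le_iff]
      rintro _ ⟨i, rfl⟩
      fin_cases i
      · exact one_mem _
      · exact IntermediateField.subset_adjoin _ _ (by simp)
      · exact IntermediateField.subset_adjoin _ _ (by simp)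
      · exact IntermediateField.subset_adjoin _ _ (by simp)
  obtain ⟨W, hW, s, hs, hs0, hls⟩ := KleinCF.exists_conjugates hl rfl hl₁ hK'
  have hWv : (fun j => (W j : ℝ)) = ![1, α, β, γ] := funext hW
  have hW0 : W 0 = 1 := Subtype.ext (hW 0)
  rw [← hWv]
  constructor
  · rintro ⟨G, ⟨hsym, hD⟩, C, hC, p, hp, hGp⟩
    obtain ⟨b, hb, π, hπ⟩ := KleinCF.exists_permutes_of_fixed hl hsym hC hp hGp
    refine KleinCF.exists_tenRelations hW0 hs hs0 hls hb hπ ?_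
    rintro rfl
    refine hD ⟨hsym, fun i => ?_⟩
    rw [hb, Submodule.map_span, Set.image_singleton, hπ]
    rfl
  · rintro ⟨σ, hσ, hσ0, ⟨-, -, τ, hτ, hττ, -⟩, ω, ψ, -, -, h⟩
    have hττ' : ∀ x, τ (τ x) = x := fun x => congrArg (fun f => f x) hττ
    have hσ2 : ∀ x, σ 2 x = (τ x : K) := fun x => by rw [← hτ]; rfl
    rw [hσ2, hσ2] at h
    obtain ⟨u, M, hu0, hequiv, hM⟩ := KleinCF.exists_integer_matrix_of_tenRelations hττ' h
    refine KleinCF.exists_symmetry_of_invariant_lattice hl hs hls hττ' ?_ hu0 hequiv hM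
    -- If `τ` were the identity, the distinct embeddings `σ 0` and `σ 2` would coincide.
    by_contra! hid
    have h02 : σ 0 = σ 2 := AlgHom.ext fun x => by
      rw [hσ2, hid, hσ0]
      rfl
    exact absurd (hσ.1 h02) (by decide)
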